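/- Let $\Delta$ be a (finite, reduced, crystallographic) irreducible root system, i.e. the root system of a simply-connected simple complex Lie group, with simple roots $\alpha_1,\dots,\alpha_r$, highest root $\theta=-\alpha_0$, Weyl group $W$, weight lattice $P$ and coroot lattice $Q^\vee$. Put $P_{\mathbb Q}=P\otimes\mathbb Q$, which is the $\mathbb Q$-span of $\Delta$, and $S=\mathrm{Sym}\,P_{\mathbb Q}$, and for $\alpha\in\Delta$ let $\partial_\alpha(f)=(f-s_\alpha f)/\alpha$ for $f\in S$. Let $W_{\mathrm{af}}=W\ltimes Q^\vee$ be the affine Weyl group, $t_\lambda\in W_{\mathrm{af}}$ the translation by $\lambda\in Q^\vee$, $s_{\alpha,k}=t_{k\alpha^\vee}s_\alpha$ for $\alpha\in\Delta$, $k\in\mathbb Z$, and $s_0=s_{\theta,1}$, $s_i=s_{\alpha_i,0}$ for $1\le i\le r$. Let $m_{ij}\in\{1,2,\dots\}\cup\{\infty\}$ be the order of $s_is_j$. For $m<\infty$ write $[x,y]_m=(xy)^{\lfloor m/2\rfloor}x^{\,m-2\lfloor m/2\rfloor}$ (the alternating product $xyx\cdots$ with $m$ factors). The affine nil-Coxeter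 algebra $\mathbb A_0$ is the $\mathbb Q$-algebra generated by $\tau_0,\dots,\tau_r$ with relations $\tau_i^2=0$ for all $i$, and $[\tau_i,\tau_j]_{m_{ij}}=[\tau_j,\tau_i]_{m_{ij}}$ for $i\ne j$ with $m_{ij}<\infty$. The affine nil-Hecke algebra is the crossed product $\mathbb A=\mathbb A_0\ltimes S$ with cross relations $\tau_if=\partial_{\alpha_i}(f)+s_{\alpha_i}(f)\tau_i$ for $f\in S$, $i=0,1,\dots,r$. For a vector space $M$ with a braiding $\psi:M\otimes M\to M\otimes M$, let $\psi_i$ be $\psi$ applied to the components $i,i+1$ of $M^{\otimes n}$, put $\Psi_w=\psi_{i_1}\cdots\psi_{i_l}$ for a reduced expression $w=s_{i_1}\cdots s_{i_l}$ of $w\in S_n$ in the adjacent transpositions, and $\sigma_n=\sum_{w\in S_n}\Psi_w$. The Nichols–Woronowicz algebra of $M$ is $\mathcal B(M)=\bigoplus_{n\ge0}M^{\otimes n}/\mathrm{Ker}(\sigma_n)$, the quotient of the tensor algebra by the kernels of the $\sigma_n$. Let $V_{\mathrm{af}}$ be the $\mathbb Q$-vector space generated by the symbols $[\alpha,k]$,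 $\alpha\in\Delta$, $k\in\mathbb Z$, with relations $[\alpha,k]+[-\alpha,-k]=0$. It is a Yetter–Drinfeld module over $W_{\mathrm{af}}$ with $w[\alpha,k]=[w\alpha,k]$ for $w\in W$, $t_\lambda[\alpha,k]=[\alpha,k+\langle\alpha,\lambda\rangle]$ for $\lambda\in Q^\vee$, and $[\alpha,k]$ homogeneous of degree $s_{\alpha,k}$, hence is braided by $\psi(a\otimes b)=g(b)\otimes a$ for $a$ of degree $g$. Let $\mathcal B_{\mathrm{af}}=\mathcal B(V_{\mathrm{af}})$, and let $\mathcal B_{\mathrm{af}}(S)=\mathcal B_{\mathrm{af}}\ltimes S$ be its extension by the cross relations $[\alpha,k]f=\partial_\alpha(f)+s_\alpha(f)[\alpha,k]$ for $\alpha\in\Delta$, $k\in\mathbb Z$, $f\in S$. **Proposition.** There is a homomorphism of $\mathbb Q$-algebras $\varphi:\mathbb A\to\mathcal B_{\mathrm{af}}(S)$ with $\varphi(\tau_0)=[\alpha_0,-1]$, $\varphi(\tau_i)=[\alpha_i,0]$ for $i=1,\dots,r$, and $\varphi(f)=f$ for $f\in S$. Moreover, the elements $a_0=[\alpha_0,-1]$,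 $a_i=[\alpha_i,0]$ $(1\le i\le r)$ satisfy the nil-Coxeter relations inside $\mathcal B_{\mathrm{af}}$: $a_i^2=0$ for all $i$, and $[a_i,a_j]_{m_{ij}}=[a_j,a_i]_{m_{ij}}$ whenever $i\ne j$ and $m_{ij}<\infty$. -/

import Mathlib

open scoped TensorProduct

noncomputable section

namespace AffineNilHecke

section Braided

/-- The adjacent transposition `(i, i+1)` of `Fin (n + 1)`. -/
def adjSwap {n : ℕ} (i : Fin n) : Equiv.Perm (Fin (n + 1)) :=
  Equiv.swap i.castSucc i.succ

/-- A word in the adjacent transpositions is a reduced expression of `w` if its product is `w` and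
no shorter word has this property. -/
def IsReducedExpression {n : ℕ} (l : List (Fin n)) (w : Equiv.Perm (Fin (n + 1))) : Prop :=
  (l.map adjSwap).prod = w ∧
    ∀ l' : List (Fin n), (l'.map adjSwap).prod = w → l.length ≤ l'.length

/-- The word `(i - 1, …, 1, 0)`. -/
def descWord {n : ℕ} (i : Fin (n + 1)) : List (Fin n) :=
  Fin.induction [] (fun j l => j :: l) i

/-- A reduced expression of a permutation `w`, as proved in `isReducedExpression_reducedWord`. It is
obtained from the factorization `w = s_{p-1} ⋯ s_1 s_0 · v`, where `p = w 0` and `v` fixes `0`. -/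
def reducedWord : (n : ℕ) → Equiv.Perm (Fin (n + 1)) → List (Fin n)
  | 0, _ => []
  | n + 1, w =>
    descWord (w 0) ++
      (reducedWord n (Equiv.Perm.decomposeFin ((w 0).cycleRange * w)).2).map Fin.succ

/-- The number of inversions of a permutation. -/
def invCount {n : ℕ} (w : Equiv.Perm (Fin n)) : ℕ :=
  (Finset.univ.filter fun p : Fin n × Fin n => p.1 < p.2 ∧ w p.2 < w p.1).card

theorem invCount_one {n : ℕ} : invCount (1 : Equiv.Perm (Fin n)) = 0 := by
  simp only [invCount, Finset.card_eq_zero, Finset.filter_eq_empty_iff]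
  rintro ⟨a, b⟩ - ⟨h1, h2⟩
  exact absurd h1 (not_lt.mpr h2.le)

theorem adjSwap_lt {n : ℕ} (i : Fin n) {a b : Fin (n + 1)} (h : a < b)
    (hne : ¬ (a = i.castSucc ∧ b = i.succ)) : adjSwap i a < adjSwap i b := by
  simp only [adjSwap, Equiv.swap_apply_def]
  simp only [Fin.lt_def, Fin.ext_iff, Fin.val_castSucc, Fin.val_succ] at h hne ⊢
  split_ifs <;> (try simp only [Fin.val_castSucc, Fin.val_succ]) <;> omega

theorem invCount_adjSwap_mul {n : ℕ} (i : Fin n) (w : Equiv.Perm (Fin (n + 1))) :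
    invCount (adjSwap i * w) ≤ invCount w + 1 := by
  classical
  have hsub : (Finset.univ.filter fun p : Fin (n+1) × Fin (n+1) =>
      p.1 < p.2 ∧ (adjSwap i * w) p.2 < (adjSwap i * w) p.1) ⊆
      insert (w.symm i.castSucc, w.symm i.succ)
        (Finset.univ.filter fun p : Fin (n+1) × Fin (n+1) => p.1 < p.2 ∧ w p.2 < w p.1) := by
    intro ⟨a, b⟩ h
    obtain ⟨hab, hw⟩ := (Finset.mem_filter.mp h).2
    simp only [Finset.mem_filter, Finset.mem_univ, true_and, Finset.mem_insert, Prod.mk.injEq,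
      Equiv.Perm.mul_apply] at hab hw ⊢
    by_contra hc
    push Not at hc
    have h1 : w a < w b := lt_of_le_of_ne (hc.2 hab) (fun e => hab.ne (w.injective e))
    refine absurd (adjSwap_lt i h1 ?_) (not_lt.mpr hw.le)
    rintro ⟨e1, e2⟩
    exact hc.1 (by simp [← e1]) (by simp [← e2])
  exact (Finset.card_le_card hsub).trans (Finset.card_insert_le _ _)

theorem invCount_prod_le {n : ℕ} (l : List (Fin n)) :
    invCount (l.map adjSwap).prod ≤ l.length := by
  induction l with
  | nil => simp [invCount_one]
  | cons i l ih =>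
    simp only [List.map_cons, List.prod_cons, List.length_cons]
    exact (invCount_adjSwap_mul i _).trans (by omega)

theorem decomposeFin_symm_zero_succ {n : ℕ} (e : Equiv.Perm (Fin n)) (j : Fin n) :
    Equiv.Perm.decomposeFin.symm (0, e) j.succ = (e j).succ := by
  simp

theorem tail_succ {n : ℕ} (w : Equiv.Perm (Fin (n + 1))) (j : Fin n) :
    (w 0).succAbove ((Equiv.Perm.decomposeFin ((w 0).cycleRange * w)).2 j) = w j.succ := by
  set g := (w 0).cycleRange * w with hg
  have h0 : g 0 = 0 := by simp [hg]
  have h1 : (Equiv.Perm.decomposeFin g).1 = 0 := by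
    have := Equiv.Perm.decomposeFin_symm_apply_zero (Equiv.Perm.decomposeFin g).1
      (Equiv.Perm.decomposeFin g).2
    rw [Prod.mk.eta, Equiv.symm_apply_apply, h0] at this
    exact this.symm
  have h2 : g j.succ = ((Equiv.Perm.decomposeFin g).2 j).succ := by
    rw [← decomposeFin_symm_zero_succ, ← h1, Prod.mk.eta, Equiv.symm_apply_apply]
  apply (w 0).cycleRange.injective
  rw [Fin.cycleRange_succAbove, ← h2]
  rfl

theorem length_descWord {n : ℕ} (p : Fin (n + 1)) : (descWord p).length = p := by
  induction p using Fin.induction with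
  | zero => simp [descWord]
  | succ i ih => simpa [descWord] using ih

theorem length_reducedWord : ∀ (n : ℕ) (w : Equiv.Perm (Fin (n + 1))),
    (reducedWord n w).length = invCount w
  | 0, w => by
    have : w = 1 := Equiv.ext fun j => Subsingleton.elim (α := Fin 1) _ _
    rw [this, invCount_one]; rfl
  | n + 1, w => by
    classical
    set e := (Equiv.Perm.decomposeFin ((w 0).cycleRange * w)).2 with he
    have ih := length_reducedWord n e
    have hw : ∀ j, w j.succ = (w 0).succAbove (e j) := fun j => (tail_succ w j).symm
    simp only [reducedWord, List.length_append, List.length_map]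
    rw [← he, ih]
    have hsplit : invCount w =
        (Finset.univ.filter fun j : Fin (n + 1) => w j.succ < w 0).card + invCount e := by
      have : (Finset.univ.filter fun p : Fin (n+2) × Fin (n+2) => p.1 < p.2 ∧ w p.2 < w p.1) =
          ((Finset.univ.filter fun j : Fin (n + 1) => w j.succ < w 0).image
            fun j => ((0 : Fin (n+2)), j.succ)) ∪
          ((Finset.univ.filter fun p : Fin (n+1) × Fin (n+1) => p.1 < p.2 ∧ e p.2 < e p.1).image
            fun p => (p.1.succ, p.2.succ)) := by
        ext ⟨a, b⟩
        simp only [Finset.mem_filter, Finset.mem_univ, true_and, Finset.mem_union,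
          Finset.mem_image, Prod.mk.injEq, Prod.exists]
        refine Fin.cases ?_ (fun a => ?_) a <;> refine Fin.cases ?_ (fun b => ?_) b
        · simp
        · simp [eq_comm]
        · simp
        · simp [hw, Fin.succAbove_lt_succAbove_iff, (Fin.succ_ne_zero _).symm]
      rw [invCount, this, Finset.card_union_of_disjoint, Finset.card_image_of_injective,
        Finset.card_image_of_injective]
      · rfl
      · rintro ⟨a, b⟩ ⟨c, d⟩ h; simpa using h
      · intro a b h; simpa using h
      · rw [Finset.disjoint_left]
        rintro ⟨a, b⟩ h1 h2
        simp only [Finset.mem_image, Prod.mk.injEq, Prod.exists] at h1 h2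
        obtain ⟨j, -, h3, -⟩ := h1
        obtain ⟨x, y, -, h4, -⟩ := h2
        exact Fin.succ_ne_zero x (h4.trans h3.symm)
    rw [hsplit]
    congr 1
    have h1 : (descWord (w 0)).length =
        (Finset.univ.filter fun i : Fin (n + 1) => i.castSucc < w 0).card := by
      have h2 := Fintype.card_fin_lt_of_le (Nat.lt_succ_iff.mp (w 0).isLt)
      rw [Fintype.card_subtype] at h2
      rw [length_descWord, ← h2]
      rfl
    rw [h1]
    symm
    refine Finset.card_bij (fun j _ => e j) ?_ ?_ ?_
    · intro j hj
      simp only [Finset.mem_filter, Finset.mem_univ, true_and, hw] at hj ⊢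
      exact Fin.succAbove_lt_iff_castSucc_lt _ _ |>.mp hj
    · intro a _ b _ h; exact e.injective h
    · intro i hi
      refine ⟨e.symm i, ?_, by simp⟩
      simp only [Finset.mem_filter, Finset.mem_univ, true_and, hw, Equiv.apply_symm_apply] at hi ⊢
      exact Fin.succAbove_lt_iff_castSucc_lt _ _ |>.mpr hi

theorem prod_map_succ {n : ℕ} (l : List (Fin n)) (j : Fin (n + 1)) :
    ((l.map Fin.succ).map adjSwap).prod j.succ = ((l.map adjSwap).prod j).succ ∧
    ((l.map Fin.succ).map adjSwap).prod 0 = 0 := by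
  induction l with
  | nil => simp
  | cons i l ih =>
    simp only [List.map_cons, List.prod_cons, Equiv.Perm.mul_apply, ih]
    constructor
    · simp only [adjSwap, ← Fin.succ_castSucc, Equiv.swap_apply_def, Fin.succ_inj]
      split_ifs <;> rfl
    · exact Equiv.swap_apply_of_ne_of_ne (by simp [Fin.ext_iff]) (by simp [Fin.ext_iff])

theorem prod_descWord {n : ℕ} (p : Fin (n + 1)) :
    ((descWord p).map adjSwap).prod = p.cycleRange⁻¹ := by
  induction p using Fin.induction with
  | zero => simp [descWord]
  | succ i ih =>
    have : descWord i.succ = i :: descWord i.castSucc := by simp [descWord]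
    have h2 : i.succ.cycleRange = i.castSucc.cycleRange * adjSwap i := by
      ext j
      rw [Equiv.Perm.mul_apply, adjSwap]
      rcases lt_trichotomy j i.castSucc with h | h | h
      · have h3 : j < i.succ := h.trans (Fin.castSucc_lt_succ)
        rw [Equiv.swap_apply_of_ne_of_ne h.ne h3.ne, Fin.coe_cycleRange_of_lt h,
          Fin.coe_cycleRange_of_lt h3]
      · subst h
        rw [Equiv.swap_apply_left, Fin.coe_cycleRange_of_lt Fin.castSucc_lt_succ,
          Fin.cycleRange_of_gt Fin.castSucc_lt_succ]
        simp
      · rcases eq_or_ne j i.succ with rfl | hne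
        · simp
        · have h3 : i.succ < j := lt_of_le_of_ne (Fin.castSucc_lt_iff_succ_le.mp h) hne.symm
          rw [Equiv.swap_apply_of_ne_of_ne h.ne' hne, Fin.cycleRange_of_gt h,
            Fin.cycleRange_of_gt h3]
    rw [this, List.map_cons, List.prod_cons, ih, h2, mul_inv_rev, adjSwap, Equiv.swap_inv]

theorem prod_reducedWord : ∀ (n : ℕ) (w : Equiv.Perm (Fin (n + 1))),
    ((reducedWord n w).map adjSwap).prod = w
  | 0, w => Equiv.ext fun j => Subsingleton.elim (α := Fin 1) _ _
  | n + 1, w => by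
    simp only [reducedWord, List.map_append, List.prod_append]
    rw [prod_descWord, inv_mul_eq_iff_eq_mul]
    set e := (Equiv.Perm.decomposeFin ((w 0).cycleRange * w)).2 with he
    have ih := prod_reducedWord n e
    ext1 j
    refine Fin.cases ?_ (fun j => ?_) j
    · rw [(prod_map_succ _ 0).2]; simp
    · rw [(prod_map_succ _ j).1, ih, Equiv.Perm.mul_apply, ← tail_succ w j,
        Fin.cycleRange_succAbove]

theorem isReducedExpression_reducedWord (n : ℕ) (w : Equiv.Perm (Fin (n + 1))) :
    IsReducedExpression (reducedWord n w) w := by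
  refine ⟨prod_reducedWord n w, fun l' h => ?_⟩
  rw [length_reducedWord, ← h]
  exact invCount_prod_le l'

end Braided

section Nichols

variable {K M : Type*} [Field K] [AddCommGroup M] [Module K M]

/-- For a pure tensor `x₀ ⊗ ⋯ ⊗ xₙ`, the linear map `M ⊗ M → M^{⊗ (n + 1)}` which puts `a ⊗ b` in the
places `i, i + 1` and keeps the other `x_j`. -/
def insertPair {n : ℕ} (x : Fin (n + 1) → M) (i : Fin n) : M ⊗[K] M →ₗ[K] ⨂[K]^(n + 1) M :=
  TensorProduct.lift <| LinearMap.mk₂ K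
    (fun a b => PiTensorProduct.tprod K (Function.update (Function.update x i.castSucc a) i.succ b))
    (fun a a' b => by
      simp only [Function.update_comm (Fin.castSucc_lt_succ (i := i)).ne _ _ x,
        MultilinearMap.map_update_add])
    (fun c a b => by
      simp only [Function.update_comm (Fin.castSucc_lt_succ (i := i)).ne _ _ x,
        MultilinearMap.map_update_smul])
    (fun a b b' => by simp only [MultilinearMap.map_update_add])
    (fun c a b => by simp only [MultilinearMap.map_update_smul])

theorem insertPair_tmul {n : ℕ} (x : Fin (n + 1) → M) (i : Fin n) (a b : M) :
    insertPair (K := K) x i (a ⊗ₜ b) =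
      PiTensorProduct.tprod K (Function.update (Function.update x i.castSucc a) i.succ b) := rfl

theorem insertPair_update_left {n : ℕ} (x : Fin (n + 1) → M) (i : Fin n) (a : M) :
    insertPair (K := K) (Function.update x i.castSucc a) i = insertPair x i := by
  refine TensorProduct.ext' fun c d => ?_
  simp only [insertPair_tmul, Function.update_idem]

theorem insertPair_update_right {n : ℕ} (x : Fin (n + 1) → M) (i : Fin n) (a : M) :
    insertPair (K := K) (Function.update x i.succ a) i = insertPair x i := by
  refine TensorProduct.ext' fun c d => ?_
  simp only [insertPair_tmul, Function.update_comm (Fin.castSucc_lt_succ (i := i)).ne,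
    Function.update_idem]

theorem insertPair_update_add {n : ℕ} (x : Fin (n + 1) → M) (i : Fin n) {j : Fin (n + 1)}
    (h : j ≠ i.castSucc) (h' : j ≠ i.succ) (a b : M) :
    insertPair (K := K) (Function.update x j (a + b)) i =
      insertPair (Function.update x j a) i + insertPair (Function.update x j b) i := by
  refine TensorProduct.ext' fun c d => ?_
  simp only [insertPair_tmul, LinearMap.add_apply, Function.update_comm h, Function.update_comm h',
    MultilinearMap.map_update_add]

theorem insertPair_update_smul {n : ℕ} (x : Fin (n + 1) → M) (i : Fin n) {j : Fin (n + 1)}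
    (h : j ≠ i.castSucc) (h' : j ≠ i.succ) (c : K) (a : M) :
    insertPair (K := K) (Function.update x j (c • a)) i =
      c • insertPair (Function.update x j a) i := by
  refine TensorProduct.ext' fun c d => ?_
  simp only [insertPair_tmul, LinearMap.smul_apply, Function.update_comm h,
    Function.update_comm h', MultilinearMap.map_update_smul]

/-- The endomorphism `ψ_i` of `M^{⊗ (n + 1)}` which applies `ψ` to the components `i, i + 1`. -/
def braidAt (ψ : M ⊗[K] M →ₗ[K] M ⊗[K] M) {n : ℕ} (i : Fin n) : Module.End K (⨂[K]^(n + 1) M) :=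
  PiTensorProduct.lift
    { toFun := fun x => insertPair x i (ψ (x i.castSucc ⊗ₜ x i.succ))
      map_update_add' := by
        intro dec x j a b
        obtain rfl : dec = instDecidableEqFin _ := Subsingleton.elim _ _
        have hne := (Fin.castSucc_lt_succ (i := i)).ne
        by_cases h : j = i.castSucc
        · subst h
          simp [insertPair_update_left, Function.update_of_ne hne.symm, TensorProduct.add_tmul]
        by_cases h' : j = i.succ
        · subst h'
          simp [insertPair_update_right, Function.update_of_ne hne, TensorProduct.tmul_add]
        simp [insertPair_update_add x i h h', Function.update_of_ne (Ne.symm h),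
          Function.update_of_ne (Ne.symm h')]
      map_update_smul' := by
        intro dec x j c a
        obtain rfl : dec = instDecidableEqFin _ := Subsingleton.elim _ _
        have hne := (Fin.castSucc_lt_succ (i := i)).ne
        by_cases h : j = i.castSucc
        · subst h
          simp [insertPair_update_left, Function.update_of_ne hne.symm, ← TensorProduct.smul_tmul']
        by_cases h' : j = i.succ
        · subst h'
          simp [insertPair_update_right, Function.update_of_ne hne]
        simp [insertPair_update_smul x i h h', Function.update_of_ne (Ne.symm h),
          Function.update_of_ne (Ne.symm h')] }

theorem braidAt_tprod (ψ : M ⊗[K] M →ₗ[K] M ⊗[K] M) {n : ℕ} (i : Fin n) (x : Fin (n + 1) → M) :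
    braidAt ψ i (PiTensorProduct.tprod K x) =
      insertPair x i (ψ (x i.castSucc ⊗ₜ x i.succ)) :=
  PiTensorProduct.lift.tprod x

/-- The endomorphism `Ψ_w = ψ_{i₁} ⋯ ψ_{i_l}`, where `w = s_{i₁} ⋯ s_{i_l}` is a reduced expression.
When `ψ` satisfies the braid relations, `Ψ_w` does not depend on the reduced expression. -/
def braidPerm (ψ : M ⊗[K] M →ₗ[K] M ⊗[K] M) {n : ℕ} (w : Equiv.Perm (Fin (n + 1))) :
    Module.End K (⨂[K]^(n + 1) M) :=
  ((reducedWord n w).map (braidAt ψ)).prod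

/-- The Woronowicz symmetrizer `σ_n = ∑_{w ∈ S_n} Ψ_w` on `M^{⊗ n}`. -/
def symmetrizer (ψ : M ⊗[K] M →ₗ[K] M ⊗[K] M) : (n : ℕ) → Module.End K (⨂[K]^n M)
  | 0 => 1
  | n + 1 => ∑ w : Equiv.Perm (Fin (n + 1)), braidPerm ψ w

/-- The relations `x = 0` for `x ∈ Ker σ_n`, `n ≥ 0`. -/
inductive NicholsRel (ψ : M ⊗[K] M →ₗ[K] M ⊗[K] M) :
    TensorAlgebra K M → TensorAlgebra K M → Prop
  | of (n : ℕ) (x : ⨂[K]^n M) (hx : symmetrizer ψ n x = 0) :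
      NicholsRel ψ (TensorPower.toTensorAlgebra x) 0

/-- The Nichols–Woronowicz algebra `B(M) = ⨁ₙ M^{⊗ n} / Ker σ_n`: the tensor algebra of `M` modulo
the two-sided ideal generated by all `Ker σ_n`. For a braiding `ψ` the direct sum of these kernels
is already a two-sided ideal. -/
abbrev NicholsAlgebra (ψ : M ⊗[K] M →ₗ[K] M ⊗[K] M) : Type _ := RingQuot (NicholsRel ψ)

/-- The degree one map `M → B(M)`. -/
def NicholsAlgebra.ι (ψ : M ⊗[K] M →ₗ[K] M ⊗[K] M) : M →ₗ[K] NicholsAlgebra ψ :=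
  (RingQuot.mkAlgHom K (NicholsRel ψ)).toLinearMap ∘ₗ TensorAlgebra.ι K

end Nichols

section YetterDrinfeld

open Classical in
/-- A Yetter–Drinfeld module over a group `Γ`: a `Γ`-module `M` with a `Γ`-grading
`M = ⨁_g M_g` such that `h M_g ⊆ M_{h g h⁻¹}`. -/
structure YetterDrinfeldModule (K Γ M : Type*) [Field K] [Group Γ] [AddCommGroup M]
    [Module K M] where
  /-- the action of `Γ` -/
  ρ : Representation K Γ M
  /-- the homogeneous components -/
  component : Γ → Submodule K M
  isInternal : DirectSum.IsInternal component
  map_mem : ∀ (h g : Γ) (v : M), v ∈ component g → ρ h v ∈ component (h * g * h⁻¹)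

variable {K Γ M : Type*} [Field K] [Group Γ] [AddCommGroup M] [Module K M]

open Classical in
/-- The braiding `ψ(a ⊗ b) = g(b) ⊗ a` for `a ∈ M_g`, extended linearly. -/
def YetterDrinfeldModule.braiding (Y : YetterDrinfeldModule K Γ M) :
    M ⊗[K] M →ₗ[K] M ⊗[K] M :=
  TensorProduct.lift <|
    (DirectSum.toModule K Γ (M →ₗ[K] M ⊗[K] M) fun g =>
      LinearMap.lcomp K (M ⊗[K] M) (Y.ρ g) ∘ₗ (TensorProduct.mk K M M).flip ∘ₗ
        (Y.component g).subtype) ∘ₗ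
    (LinearEquiv.ofBijective (DirectSum.coeLinearMap Y.component) Y.isInternal).symm.toLinearMap

theorem YetterDrinfeldModule.braiding_tmul (Y : YetterDrinfeldModule K Γ M) {g : Γ} {a : M}
    (ha : a ∈ Y.component g) (b : M) : Y.braiding (a ⊗ₜ b) = Y.ρ g b ⊗ₜ a := by
  classical
  have h : (LinearEquiv.ofBijective (DirectSum.coeLinearMap Y.component) Y.isInternal).symm a =
      DirectSum.lof K Γ (fun g => Y.component g) g ⟨a, ha⟩ := by
    rw [LinearEquiv.symm_apply_eq]
    exact (DirectSum.coeLinearMap_lof Y.component g ⟨a, ha⟩).symm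
  rw [braiding, TensorProduct.lift.tmul, LinearMap.comp_apply, LinearEquiv.coe_coe]
  rw! [h]
  simp

end YetterDrinfeld

section AffineWeyl

variable {ι V V' : Type*} [AddCommGroup V] [Module ℚ V] [AddCommGroup V'] [Module ℚ V']
  (P : RootPairing ι ℚ V V')

/-- The (covariant) action of the automorphisms of a root system on the coroot space. -/
def corootAct : P.Aut →* (V' ≃ₗ[ℚ] V') where
  toFun g := (RootPairing.Equiv.coweightEquiv P P g)⁻¹
  map_one' := by
    rw [inv_eq_one]
    exact LinearEquiv.toLinearMap_inj.mp rfl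
  map_mul' g h := by
    rw [← mul_inv_rev]
    exact congrArg _ (LinearEquiv.toLinearMap_inj.mp rfl)

theorem corootAct_coroot (g : P.Aut) (i : ι) :
    corootAct P g (P.coroot i) = P.coroot (g.indexEquiv i) := by
  change (RootPairing.Equiv.coweightEquiv P P g).symm (P.coroot i) = _
  rw [LinearEquiv.symm_apply_eq, RootPairing.Equiv.coweightEquiv_apply,
    RootPairing.Hom.coroot_coweightMap_apply]
  simp

theorem toLinearMap_corootAct (g : P.Aut) (v : V) (n : V') :
    P.toLinearMap (g • v) (corootAct P g n) = P.toLinearMap v n := by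
  obtain ⟨m, rfl⟩ := (RootPairing.Equiv.coweightEquiv P P g).surjective n
  have h1 : corootAct P g (RootPairing.Equiv.coweightEquiv P P g m) = m :=
    (RootPairing.Equiv.coweightEquiv P P g).symm_apply_apply m
  rw [h1]
  have h := RootPairing.Hom.weight_coweight_transpose_apply P P m g.toHom
  exact LinearMap.congr_fun h v

theorem corootAct_mem (g : P.Aut) {n : V'} (hn : n ∈ P.corootSpan ℤ) :
    corootAct P g n ∈ P.corootSpan ℤ := by
  induction hn using Submodule.span_induction with
  | mem x hx =>
    obtain ⟨i, rfl⟩ := hx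
    rw [corootAct_coroot]
    exact Submodule.subset_span ⟨_, rfl⟩
  | zero => simp
  | add x y _ _ hx hy => rw [map_add]; exact add_mem hx hy
  | smul c x _ hx => rw [map_zsmul]; exact Submodule.smul_mem _ _ hx

/-- The action of the Weyl group `W` on the coroot lattice `Q^∨` (written multiplicatively). -/
def corootLatticeAct : P.weylGroup →* MulAut (Multiplicative (P.corootSpan ℤ)) where
  toFun w := AddEquiv.toMultiplicative
    { toFun := fun x => ⟨corootAct P w x, corootAct_mem P w x.2⟩
      invFun := fun x => ⟨corootAct P (w⁻¹ : P.weylGroup) x, corootAct_mem P _ x.2⟩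
      left_inv := fun x => Subtype.ext <| by
        simp
      right_inv := fun x => Subtype.ext <| by
        simp
      map_add' := fun x y => Subtype.ext <| by simp }
  map_one' := by ext x; simp
  map_mul' v w := by
    ext x
    exact LinearEquiv.congr_fun (map_mul (corootAct P) (v : P.Aut) (w : P.Aut)) _

/-- The affine Weyl group `W_af = W ⋉ Q^∨`. -/
abbrev AffineWeylGroup : Type _ :=
  Multiplicative (P.corootSpan ℤ) ⋊[corootLatticeAct P] P.weylGroup

/-- The affine reflection `s_{α,k} = t_{k α^∨} s_α`, i.e. the reflection in the hyperplane
`{x | ⟨α, x⟩ = k}` of the coroot space. -/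
def affineReflection (a : ι × ℤ) : AffineWeylGroup P :=
  ⟨Multiplicative.ofAdd (a.2 • P.corootSpanMem ℤ a.1), RootPairing.weylGroup.ofIdx P a.1⟩

/-- The pair `(-α, -k)`. -/
def negAffine (a : ι × ℤ) : ι × ℤ := (P.reflectionPerm a.1 a.1, -a.2)

/-- The action of `W_af` on the pairs `(α, k)`, `α ∈ Δ`, `k ∈ ℤ`, determined by
`w (α, k) = (w α, k)` for `w ∈ W` and `t_λ (α, k) = (α, k + ⟨α, λ⟩)` for `λ ∈ Q^∨`. -/
def affineAct [P.IsCrystallographic] (g : AffineWeylGroup P) (a : ι × ℤ) : ι × ℤ :=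
  (P.weylGroupToPerm g.right a.1,
    a.2 + P.root'In ℤ (P.weylGroupToPerm g.right a.1) (Multiplicative.toAdd g.left))

theorem weylGroupToPerm_neg (w : P.weylGroup) (i : ι) :
    P.weylGroupToPerm w (P.reflectionPerm i i) =
      P.reflectionPerm (P.weylGroupToPerm w i) (P.weylGroupToPerm w i) := by
  apply P.root.injective
  rw [← P.weylGroup_apply_root, P.root_reflectionPerm, P.root_reflectionPerm,
    P.reflection_apply_self, P.reflection_apply_self, smul_neg, P.weylGroup_apply_root]

theorem ofIdx_neg (i : ι) :
    RootPairing.weylGroup.ofIdx P (P.reflectionPerm i i) = RootPairing.weylGroup.ofIdx P i := by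
  apply Subtype.ext
  apply RootPairing.Equiv.weightHom_injective
  ext v
  change P.reflection _ v = P.reflection _ v
  rw [P.reflection_reflectionPerm]
  simp [LinearEquiv.mul_apply]

theorem mul_ofIdx (w : P.weylGroup) (i : ι) :
    w * RootPairing.weylGroup.ofIdx P i =
      RootPairing.weylGroup.ofIdx P (P.weylGroupToPerm w i) * w := by
  apply Subtype.ext
  apply RootPairing.Equiv.weightHom_injective
  ext v
  change (w : P.Aut) • P.reflection i v = P.reflection _ ((w : P.Aut) • v)
  have h1 : P.coroot (P.weylGroupToPerm w i) = corootAct P w (P.coroot i) :=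
    (corootAct_coroot P w i).symm
  have h2 : P.root (P.weylGroupToPerm w i) = (w : P.Aut) • P.root i :=
    (P.weylGroup_apply_root w i).symm
  rw [P.reflection_apply, P.reflection_apply, smul_sub, LinearMap.flip_apply,
    LinearMap.flip_apply, h1, h2, toLinearMap_corootAct]
  congr 1
  exact map_smul (RootPairing.Equiv.weightHom P (w : P.Aut)) _ _

theorem affineReflection_neg (a : ι × ℤ) :
    affineReflection P (negAffine P a) = affineReflection P a := by
  ext1
  · apply Multiplicative.toAdd.injective
    apply Subtype.ext
    simp [affineReflection, negAffine]
  · exact ofIdx_neg P a.1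

variable [P.IsCrystallographic]

theorem cast_root'In (i : ι) (x : P.corootSpan ℤ) :
    ((P.root'In ℤ i x : ℤ) : ℚ) = P.toLinearMap (P.root i) x := 
  P.algebraMap_root'In_apply ℤ i x

theorem affineAct_one (a : ι × ℤ) : affineAct P 1 a = a := by
  simp [affineAct]

theorem root'In_corootLatticeAct (w : P.weylGroup) (i : ι)
    (x : Multiplicative (P.corootSpan ℤ)) :
    P.root'In ℤ (P.weylGroupToPerm w i) (Multiplicative.toAdd (corootLatticeAct P w x)) =
      P.root'In ℤ i (Multiplicative.toAdd x) := by
  apply Int.cast_injective (α := ℚ)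
  rw [cast_root'In, cast_root'In, ← P.weylGroup_apply_root]
  exact toLinearMap_corootAct P w _ _

theorem affineAct_mul (g h : AffineWeylGroup P) (a : ι × ℤ) :
    affineAct P (g * h) a = affineAct P g (affineAct P h a) := by
  refine Prod.ext ?_ ?_
  · simp only [affineAct, SemidirectProduct.mul_right, map_mul, Equiv.Perm.mul_apply]
  · simp only [affineAct, SemidirectProduct.mul_right, SemidirectProduct.mul_left, map_mul,
      Equiv.Perm.mul_apply, toAdd_mul, map_add, root'In_corootLatticeAct]
    ring

theorem affineAct_neg (g : AffineWeylGroup P) (a : ι × ℤ) :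
    affineAct P g (negAffine P a) = negAffine P (affineAct P g a) := by
  refine Prod.ext ?_ ?_
  · exact weylGroupToPerm_neg P g.right a.1
  · simp only [affineAct, negAffine, weylGroupToPerm_neg, neg_add]
    congr 1
    apply Int.cast_injective (α := ℚ)
    rw [Int.cast_neg, cast_root'In, cast_root'In, P.root_reflectionPerm, P.reflection_apply_self,
      map_neg, LinearMap.neg_apply]

theorem mul_affineReflection (g : AffineWeylGroup P) (a : ι × ℤ) :
    g * affineReflection P a * g⁻¹ = affineReflection P (affineAct P g a) := by
  rw [mul_inv_eq_iff_eq_mul]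
  ext1
  · apply Multiplicative.toAdd.injective
    apply Subtype.ext
    have h := cast_root'In P (P.weylGroupToPerm g.right a.1) (Multiplicative.toAdd g.left)
    have e1 : ((Multiplicative.toAdd (corootLatticeAct P g.right
        (affineReflection P a).left) : P.corootSpan ℤ) : V') = a.2 • P.coroot (P.weylGroupToPerm g.right a.1) := by
      change corootAct P g.right (a.2 • P.coroot a.1) = _
      rw [map_zsmul, corootAct_coroot]
      rfl
    have e2 : ((Multiplicative.toAdd (corootLatticeAct P
        (RootPairing.weylGroup.ofIdx P (P.weylGroupToPerm g.right a.1)) g.left) : P.corootSpan ℤ) : V') =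
        P.coreflection (P.weylGroupToPerm g.right a.1) ((Multiplicative.toAdd g.left : P.corootSpan ℤ) : V') := by
      change (RootPairing.Equiv.coweightEquiv P P (RootPairing.Equiv.reflection P
        (P.weylGroupToPerm g.right a.1))).symm _ = _
      rw [RootPairing.Equiv.reflection_coweightEquiv, LinearEquiv.symm_apply_eq,
        P.coreflection_same]
    simp only [SemidirectProduct.mul_left, toAdd_mul, Submodule.coe_add]
    rw [e1]
    simp only [affineReflection, affineAct] at *
    rw [e2, P.coreflection_apply, ← h]
    simp only [toAdd_ofAdd, Submodule.coe_smul]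
    change _ + _ = (_ : ℤ) • P.coroot _ + _
    module
  · exact mul_ofIdx P g.right a.1

/-- The subspace spanned by the elements `[α, k] + [-α, -k]`. -/
def affineRelations : Submodule ℚ (ι × ℤ →₀ ℚ) :=
  Submodule.span ℚ
    (Set.range fun a => Finsupp.single a 1 + Finsupp.single (negAffine P a) 1)

/-- The vector space `V_af = ⨁ ℚ [α, k] / ([α, k] + [-α, -k])`. -/
abbrev Vaf : Type _ := (ι × ℤ →₀ ℚ) ⧸ affineRelations P

/-- The element `[α, k]` of `V_af`. -/
def Vaf.mk (a : ι × ℤ) : Vaf P := (affineRelations P).mkQ (Finsupp.single a 1)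

end AffineWeyl

section AffineNichols

variable {ι V V' : Type*} [AddCommGroup V] [Module ℚ V] [AddCommGroup V'] [Module ℚ V']
  (P : RootPairing ι ℚ V V')

theorem Vaf.mk_neg (a : ι × ℤ) : Vaf.mk P (negAffine P a) = -Vaf.mk P a := by
  rw [eq_neg_iff_add_eq_zero, Vaf.mk, Vaf.mk, ← map_add, Submodule.mkQ_apply,
    Submodule.Quotient.mk_eq_zero, add_comm]
  exact Submodule.subset_span ⟨a, rfl⟩

/-- Linear maps out of `V_af`. -/
def Vaf.lift {E : Type*} [AddCommGroup E] [Module ℚ E] (f : ι × ℤ → E)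
    (hf : ∀ a, f a + f (negAffine P a) = 0) : Vaf P →ₗ[ℚ] E :=
  (affineRelations P).liftQ (Finsupp.linearCombination ℚ f) <| by
    rw [affineRelations, Submodule.span_le]
    rintro _ ⟨a, rfl⟩
    simpa using hf a

theorem Vaf.lift_mk {E : Type*} [AddCommGroup E] [Module ℚ E] (f : ι × ℤ → E)
    (hf : ∀ a, f a + f (negAffine P a) = 0) (a : ι × ℤ) : Vaf.lift P f hf (Vaf.mk P a) = f a := by
  simp [Vaf.lift, Vaf.mk]

theorem Vaf.hom_ext {E : Type*} [AddCommGroup E] [Module ℚ E] {f g : Vaf P →ₗ[ℚ] E}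
    (h : ∀ a, f (Vaf.mk P a) = g (Vaf.mk P a)) : f = g := by
  apply Submodule.linearMap_qext
  apply Finsupp.lhom_ext'
  intro a
  ext
  exact h a

/-- The homogeneous component of degree `g`, spanned by the `[α, k]` with `s_{α,k} = g`. -/
def VafComponent (g : AffineWeylGroup P) : Submodule ℚ (Vaf P) :=
  Submodule.span ℚ (Vaf.mk P '' {a | affineReflection P a = g})

theorem Vaf.mk_mem (a : ι × ℤ) : Vaf.mk P a ∈ VafComponent P (affineReflection P a) :=
  Submodule.subset_span ⟨a, rfl, rfl⟩

theorem VafComponent_isInternal [DecidableEq (AffineWeylGroup P)] :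
    DirectSum.IsInternal (VafComponent P) := by
  let of : ∀ g, VafComponent P g →ₗ[ℚ] DirectSum _ fun g => VafComponent P g :=
    DirectSum.lof ℚ _ fun g => VafComponent P g
  have hof : ∀ (a : ι × ℤ) (g) (hg : affineReflection P a = g) (h), of g ⟨Vaf.mk P a, h⟩ =
      of (affineReflection P a) ⟨Vaf.mk P a, Vaf.mk_mem P a⟩ := by
    rintro a g rfl h; rfl
  let d : Vaf P →ₗ[ℚ] DirectSum _ fun g => VafComponent P g :=
    Vaf.lift P (fun a => of (affineReflection P a) ⟨Vaf.mk P a, Vaf.mk_mem P a⟩) fun a => by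
      rw [← hof (negAffine P a) (affineReflection P a) (affineReflection_neg P a)
        (by rw [← affineReflection_neg P a]; exact Vaf.mk_mem P _), ← map_add]
      convert map_zero (of (affineReflection P a))
      simp [Vaf.mk_neg]
  have h1 : DirectSum.coeLinearMap (VafComponent P) ∘ₗ d = LinearMap.id :=
    Vaf.hom_ext P fun a => by
      rw [LinearMap.comp_apply, Vaf.lift_mk]
      exact DirectSum.coeLinearMap_lof (VafComponent P) _ _
  have h2 : d ∘ₗ DirectSum.coeLinearMap (VafComponent P) = LinearMap.id := by
    refine DirectSum.linearMap_ext _ fun g => LinearMap.ext fun x => ?_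
    obtain ⟨x, hx⟩ := x
    have key : ∀ y (hy : y ∈ VafComponent P g), d y = of g ⟨y, hy⟩ := by
      intro y hy
      induction hy using Submodule.span_induction with
      | mem y hy =>
        obtain ⟨a, ha, rfl⟩ := hy
        exact (Vaf.lift_mk P _ _ a).trans (hof a g ha _).symm
      | zero =>
        rw [map_zero]; exact (map_zero (of g)).symm
      | add y z hy hz h h' => rw [map_add, h, h', ← map_add]; rfl
      | smul c y hy h => rw [map_smul, h, ← map_smul]; rfl
    have h3 : DirectSum.coeLinearMap (VafComponent P) (of g ⟨x, hx⟩) = x :=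
      DirectSum.coeLinearMap_lof (VafComponent P) _ _
    change d (DirectSum.coeLinearMap (VafComponent P) (of g ⟨x, hx⟩)) = of g ⟨x, hx⟩
    rw [h3, key x hx]
  refine Function.bijective_iff_has_inverse.mpr ⟨d, ?_, ?_⟩
  · exact LinearMap.congr_fun h2
  · exact LinearMap.congr_fun h1

variable [P.IsCrystallographic]

/-- The action of `W_af` on `V_af`, `g [α, k] = [g (α, k)]`. -/
def VafRep : Representation ℚ (AffineWeylGroup P) (Vaf P) where
  toFun g := Vaf.lift P (fun a => Vaf.mk P (affineAct P g a)) fun a => by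
    rw [affineAct_neg, Vaf.mk_neg, add_neg_cancel]
  map_one' := Vaf.hom_ext P fun a => by rw [Vaf.lift_mk, affineAct_one]; rfl
  map_mul' g h := Vaf.hom_ext P fun a => by
    rw [Vaf.lift_mk, Module.End.mul_apply, Vaf.lift_mk, Vaf.lift_mk, affineAct_mul]

theorem VafRep_mk (g : AffineWeylGroup P) (a : ι × ℤ) :
    VafRep P g (Vaf.mk P a) = Vaf.mk P (affineAct P g a) :=
  Vaf.lift_mk P (fun a => Vaf.mk P (affineAct P g a))
    (fun a => by rw [affineAct_neg, Vaf.mk_neg, add_neg_cancel]) a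

/-- The Yetter–Drinfeld module `V_af` over `W_af`. -/
def VafYD : YetterDrinfeldModule ℚ (AffineWeylGroup P) (Vaf P) where
  ρ := VafRep P
  component := VafComponent P
  isInternal :=
    @VafComponent_isInternal _ _ _ _ _ _ _ P fun a b => Classical.propDecidable (a = b)
  map_mem h g v hv := by
    induction hv using Submodule.span_induction with
    | mem v hv =>
      obtain ⟨a, rfl, rfl⟩ := hv
      rw [VafRep_mk, mul_affineReflection]
      exact Vaf.mk_mem P _
    | zero => rw [map_zero]; exact zero_mem _
    | add v w _ _ hv hw => rw [map_add]; exact add_mem hv hw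
    | smul c v _ hv => rw [map_smul]; exact Submodule.smul_mem _ _ hv

theorem VafYD_braiding_mk (a b : ι × ℤ) :
    (VafYD P).braiding (Vaf.mk P a ⊗ₜ Vaf.mk P b) =
      Vaf.mk P (P.reflectionPerm a.1 b.1, b.2 - P.pairingIn ℤ b.1 a.1 * a.2) ⊗ₜ Vaf.mk P a := by
  rw [(VafYD P).braiding_tmul (Vaf.mk_mem P a)]
  congr 1
  refine (VafRep_mk P _ b).trans (congrArg _ (Prod.ext rfl ?_))
  change b.2 + P.root'In ℤ (P.reflectionPerm a.1 b.1) (a.2 • P.corootSpanMem ℤ a.1) = _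
  have h : P.pairingIn ℤ (P.reflectionPerm a.1 b.1) a.1 = -P.pairingIn ℤ b.1 a.1 := by
    apply Int.cast_injective (α := ℚ)
    have h1 := P.algebraMap_pairingIn ℤ (P.reflectionPerm a.1 b.1) a.1
    have h2 := P.algebraMap_pairingIn ℤ b.1 a.1
    simp only [algebraMap_int_eq, eq_intCast] at h1 h2
    rw [Int.cast_neg, h1, h2, ← P.pairing_reflectionPerm, P.pairing_reflectionPerm_self_right]
  rw [map_smul, P.root'In_corootSpanMem_eq_pairingIn, h, smul_eq_mul]
  ring

/-- The Nichols–Woronowicz algebra `B_af = B(V_af)`. -/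
abbrev Baf : Type _ := NicholsAlgebra (VafYD P).braiding

/-- The element `[α, k]` of `B_af`. -/
def Baf.mk (a : ι × ℤ) : Baf P := NicholsAlgebra.ι (VafYD P).braiding (Vaf.mk P a)

end AffineNichols

section NilHecke

variable {ι V V' : Type*} [AddCommGroup V] [Module ℚ V] [AddCommGroup V'] [Module ℚ V']
  (P : RootPairing ι ℚ V V')

/-- The action of the reflection `s_α` on `S = Sym P_ℚ` by algebra automorphisms. -/
def symReflection (i : ι) : SymmetricAlgebra ℚ V →ₐ[ℚ] SymmetricAlgebra ℚ V :=
  SymmetricAlgebra.lift (SymmetricAlgebra.ι ℚ V ∘ₗ (P.reflection i).toLinearMap)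

theorem exists_dividedDifference (i : ι) (f : SymmetricAlgebra ℚ V) :
    ∃ g, SymmetricAlgebra.ι ℚ V (P.root i) * g = f - symReflection P i f := by
  induction f using SymmetricAlgebra.induction with
  | algebraMap r => exact ⟨0, by simp⟩
  | ι v =>
    refine ⟨algebraMap ℚ _ (P.toLinearMap v (P.coroot i)), ?_⟩
    rw [symReflection, SymmetricAlgebra.lift_ι_apply]
    simp [P.reflection_apply, mul_comm _ (algebraMap ℚ _ _), ← Algebra.smul_def]
  | mul a b ha hb =>
    obtain ⟨x, hx⟩ := ha
    obtain ⟨y, hy⟩ := hb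
    refine ⟨x * b + symReflection P i a * y, ?_⟩
    rw [map_mul]
    linear_combination b * hx + symReflection P i a * hy
  | add a b ha hb =>
    obtain ⟨x, hx⟩ := ha
    obtain ⟨y, hy⟩ := hb
    exact ⟨x + y, by rw [mul_add, hx, hy, map_add]; ring⟩

/-- The divided difference operator `∂_α(f) = (f - s_α(f)) / α` on `S`. -/
def dividedDifference (i : ι) (f : SymmetricAlgebra ℚ V) : SymmetricAlgebra ℚ V :=
  (exists_dividedDifference P i f).choose

theorem root_mul_dividedDifference (i : ι) (f : SymmetricAlgebra ℚ V) :
    SymmetricAlgebra.ι ℚ V (P.root i) * dividedDifference P i f = f - symReflection P i f :=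
  (exists_dividedDifference P i f).choose_spec

theorem eq_dividedDifference (i : ι) (f g : SymmetricAlgebra ℚ V)
    (h : SymmetricAlgebra.ι ℚ V (P.root i) * g = f - symReflection P i f) :
    g = dividedDifference P i f := by
  have h0 : SymmetricAlgebra.ι ℚ V (P.root i) ≠ 0 := fun h0 => by
    have h1 := congrArg (SymmetricAlgebra.lift (P.coroot' i)) h0
    rw [SymmetricAlgebra.lift_ι_apply, map_zero] at h1
    simp at h1
  exact mul_left_cancel₀ h0 (h.trans (root_mul_dividedDifference P i f).symm)

section Crossed

variable {K A S X : Type*} [Field K] [Ring A] [Algebra K A] [CommRing S] [Algebra K S]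

/-- The relations of `CrossedProduct`: the first four say that `A` and `S` are mapped by algebra
homomorphisms. -/
inductive CrossedRel (gen : X → A) (s : X → S →ₐ[K] S) (d : X → S → S) :
    TensorAlgebra K (A × S) → TensorAlgebra K (A × S) → Prop
  | one_left : CrossedRel gen s d (TensorAlgebra.ι K (1, 0)) 1
  | one_right : CrossedRel gen s d (TensorAlgebra.ι K (0, 1)) 1
  | mul_left (a b : A) : CrossedRel gen s d
      (TensorAlgebra.ι K (a, 0) * TensorAlgebra.ι K (b, 0)) (TensorAlgebra.ι K (a * b, 0))
  | mul_right (f g : S) : CrossedRel gen s d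
      (TensorAlgebra.ι K (0, f) * TensorAlgebra.ι K (0, g)) (TensorAlgebra.ι K (0, f * g))
  | cross (x : X) (f : S) : CrossedRel gen s d
      (TensorAlgebra.ι K (gen x, 0) * TensorAlgebra.ι K (0, f))
      (TensorAlgebra.ι K (0, d x f) +
        TensorAlgebra.ι K (0, s x f) * TensorAlgebra.ι K (gen x, 0))

/-- The crossed product `A ⋉ S`: the free product of the algebras `A` and `S` modulo the cross
relations `x f = d_x(f) + s_x(f) x`, where `x` runs over a given family of elements of `A`
and `f` over `S`. -/
abbrev CrossedProduct (gen : X → A) (s : X → S →ₐ[K] S) (d : X → S → S) : Type _ :=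
  RingQuot (CrossedRel gen s d)

variable (gen : X → A) (s : X → S →ₐ[K] S) (d : X → S → S)

/-- The canonical homomorphism `A → A ⋉ S`. -/
def CrossedProduct.inl : A →ₐ[K] CrossedProduct gen s d :=
  AlgHom.ofLinearMap
    ((RingQuot.mkAlgHom K (CrossedRel gen s d)).toLinearMap ∘ₗ TensorAlgebra.ι K ∘ₗ
      LinearMap.inl K A S)
    ((RingQuot.mkAlgHom_rel K CrossedRel.one_left).trans (map_one _))
    (fun a b => ((RingQuot.mkAlgHom_rel K (CrossedRel.mul_left a b)).symm.trans (map_mul _ _ _)))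

/-- The canonical homomorphism `S → A ⋉ S`. -/
def CrossedProduct.inr : S →ₐ[K] CrossedProduct gen s d :=
  AlgHom.ofLinearMap
    ((RingQuot.mkAlgHom K (CrossedRel gen s d)).toLinearMap ∘ₗ TensorAlgebra.ι K ∘ₗ
      LinearMap.inr K A S)
    ((RingQuot.mkAlgHom_rel K CrossedRel.one_right).trans (map_one _))
    (fun a b => ((RingQuot.mkAlgHom_rel K (CrossedRel.mul_right a b)).symm.trans (map_mul _ _ _)))

end Crossed

variable {P} (b : P.Base) (θ : ι)

/-- `θ` is the highest root: `θ - β` is a sum of simple roots for every root `β`. -/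
def IsHighestRoot : Prop :=
  ∀ j : ι, P.root θ - P.root j ∈ AddSubmonoid.closure (P.root '' b.support)

/-- The nodes `0, 1, …, r` of the affine Dynkin diagram; `none` is the node `0`. -/
abbrev AffineNode : Type _ := Option b.support

/-- The index of the root `α_i`, where `α_0 = -θ`. -/
def nodeRoot : AffineNode b → ι
  | none => P.reflectionPerm θ θ
  | some i => i

/-- The pair `(α_0, -1)` for `i = 0`, and `(α_i, 0)` for `i = 1, …, r`. -/
def nodePair : AffineNode b → ι × ℤ
  | none => (nodeRoot b θ none, -1)
  | some i => (nodeRoot b θ (some i), 0)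

/-- The simple reflections `s_0 = s_{θ,1}` and `s_i = s_{α_i,0}` of `W_af`. -/
def simpleReflection : AffineNode b → AffineWeylGroup P
  | none => affineReflection P (θ, 1)
  | some i => affineReflection P (i, 0)

/-- The order `m_{ij}` of `s_i s_j` in `W_af`; the value `0` stands for `m_{ij} = ∞`. -/
def coxeterOrder (i j : AffineNode b) : ℕ :=
  orderOf (simpleReflection b θ i * simpleReflection b θ j)

/-- The alternating product `x y x ⋯` with `m` factors, i.e. `(x y)^{[m/2]} x^{m - 2 [m/2]}`. -/
def altProd {A : Type*} [Monoid A] (x y : A) (m : ℕ) : A := (x * y) ^ (m / 2) * x ^ (m % 2)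

/-- The defining relations of the affine nil-Coxeter algebra. There is no braid relation if
`m_{ij} = ∞`. -/
inductive NilCoxeterRel :
    FreeAlgebra ℚ (AffineNode b) → FreeAlgebra ℚ (AffineNode b) → Prop
  | sq (i : AffineNode b) : NilCoxeterRel (FreeAlgebra.ι ℚ i * FreeAlgebra.ι ℚ i) 0
  | braid (i j : AffineNode b) (hij : i ≠ j) (hm : coxeterOrder b θ i j ≠ 0) : NilCoxeterRel
      (altProd (FreeAlgebra.ι ℚ i) (FreeAlgebra.ι ℚ j) (coxeterOrder b θ i j))
      (altProd (FreeAlgebra.ι ℚ j) (FreeAlgebra.ι ℚ i) (coxeterOrder b θ i j))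

/-- The affine nil-Coxeter algebra `𝔸₀`. -/
abbrev NilCoxeter : Type _ := RingQuot (NilCoxeterRel b θ)

/-- The generator `τ_i` of `𝔸₀`. -/
def NilCoxeter.τ (i : AffineNode b) : NilCoxeter b θ :=
  RingQuot.mkAlgHom ℚ (NilCoxeterRel b θ) (FreeAlgebra.ι ℚ i)

/-- The affine nil-Hecke algebra `𝔸 = 𝔸₀ ⋉ S`, with the cross relations
`τ_i f = ∂_{α_i}(f) + s_{α_i}(f) τ_i`, `i = 0, …, r`. -/
abbrev NilHecke : Type _ :=
  CrossedProduct (K := ℚ) (NilCoxeter.τ b θ) (fun i => symReflection P (nodeRoot b θ i))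
    (fun i => dividedDifference P (nodeRoot b θ i))

/-- The generator `τ_i` of `𝔸`. -/
def NilHecke.τ (i : AffineNode b) : NilHecke b θ :=
  CrossedProduct.inl _ _ _ (NilCoxeter.τ b θ i)

/-- The inclusion `S → 𝔸`. -/
def NilHecke.ofSym : SymmetricAlgebra ℚ V →ₐ[ℚ] NilHecke b θ := CrossedProduct.inr _ _ _

variable (P) [P.IsCrystallographic]

/-- The extension `B_af(S) = B_af ⋉ S`, with the cross relations
`[α, k] f = ∂_α(f) + s_α(f) [α, k]`, `α ∈ Δ`, `k ∈ ℤ`. -/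
abbrev BafS : Type _ :=
  CrossedProduct (K := ℚ) (Baf.mk P) (fun a : ι × ℤ => symReflection P a.1)
    (fun a => dividedDifference P a.1)

/-- The element `[α, k]` of `B_af(S)`. -/
def BafS.mk (a : ι × ℤ) : BafS P := CrossedProduct.inl _ _ _ (Baf.mk P a)

/-- The inclusion `S → B_af(S)`. -/
def BafS.ofSym : SymmetricAlgebra ℚ V →ₐ[ℚ] BafS P := CrossedProduct.inr _ _ _

end NilHecke

end AffineNilHecke

end

/-! The homomorphism exists as soon as the elements `a_i` satisfy the nil-Coxeter relations in
`Baf`: the cross relations of `NilHecke` are instances of those of `BafS`. So the content is that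
certain tensors lie in the kernel of the symmetrizers.

The tool is the factorization σ_{n+1} = (id ⊗ σ_n)(1 + ψ_0 + ψ_0ψ_1 + ⋯ + ψ_0⋯ψ_{n-1})
(`symSum_succ_eq_mul_coshuffleSum`). It needs only that distant ψ_i commute. On a word x_0 ⊗ ⋯ ⊗ x_n
with x_i of degree g_i it becomes the recursion `symmetrizer_wordTensor`: σ of the word is the sum
over p of (g_0⋯g_{p-1} x_p) ⊗ σ(word without x_p).

If two neighbouring letters equal a, of degree s with s a = -a, then omitting either of them gives
opposite terms, and the other terms vanish by induction, so σ kills the word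
(`symmetrizer_wordTensor_eq_zero`). In particular a² = 0. In an alternating word a b a ⋯ of length
m, omitting an inner letter creates such a repetition, so only the two end terms survive. If the
product of the degrees of the first m - 1 letters sends the last letter to b, they are a ⊗ σ(b a ⋯)
and b ⊗ σ(a b ⋯). With the condition for a and b exchanged, the word b a b ⋯ has the same
symmetrizer, and the braid relation follows (`NicholsAlgebra.altProd_ι_eq`).

The condition on the last letter is a rank two computation with Cartan integers
(`exists_orderOf_eq_and_affineAct_altProd`), valid when the two roots have nonpositive pairing and
are not opposite. For simple roots this is standard. For α_0 = -θ it comes from the maximality of θ;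
the opposite case is θ simple, where s_0 s_i is a translation and no relation is required. -/

namespace AffineNilHecke

/-! ### Factorizations of the symmetrizer -/

section Symmetrizer

section Ring

variable {R : Type*} [Ring R]

/-- The product `f_{p-1} ⋯ f_1 f_0`. -/
def descProd (f : ℕ → R) : ℕ → R
  | 0 => 1
  | p + 1 => f p * descProd f p

/-- The sum `∑_{p ≤ n} f_{p-1} ⋯ f_1 f_0`. -/
def shuffleSum (f : ℕ → R) (n : ℕ) : R := ∑ p ∈ Finset.range (n + 1), descProd f p

/-- The sum `∑_{p ≤ n} f_0 f_1 ⋯ f_{p-1}`. -/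
def coshuffleSum : (ℕ → R) → ℕ → R
  | _, 0 => 1
  | f, n + 1 => 1 + f 0 * coshuffleSum (fun i => f (i + 1)) n

/-- The sum, over the permutations of `n + 1` letters, of the products of the `f_i` along the
reduced words of `reducedWord`. -/
def symSum : (ℕ → R) → ℕ → R
  | _, 0 => 1
  | f, n + 1 => shuffleSum f (n + 1) * symSum (fun i => f (i + 1)) n

theorem descProd_succ' (f : ℕ → R) (p : ℕ) :
    descProd f (p + 1) = descProd (fun i => f (i + 1)) p * f 0 := by
  induction p with
  | zero => simp [descProd]
  | succ p ih => rw [descProd, ih, descProd, mul_assoc]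

theorem shuffleSum_succ (f : ℕ → R) (n : ℕ) :
    shuffleSum f (n + 1) = 1 + shuffleSum (fun i => f (i + 1)) n * f 0 := by
  simp only [shuffleSum, Finset.sum_range_succ' _ (n + 1), descProd_succ', Finset.sum_mul]
  exact add_comm _ _

theorem commute_descProd {x : R} {f : ℕ → R} (h : ∀ i, Commute x (f i)) (p : ℕ) :
    Commute x (descProd f p) := by
  induction p with
  | zero => exact Commute.one_right x
  | succ p ih => exact (h p).mul_right ih

theorem commute_symSum {x : R} {f : ℕ → R} (h : ∀ i, Commute x (f i)) (n : ℕ) :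
    Commute x (symSum f n) := by
  induction n generalizing f with
  | zero => exact Commute.one_right x
  | succ n ih =>
    exact (Commute.sum_right _ _ _ fun p _ => commute_descProd h p).mul_right (ih fun i => h _)

/-- Passes from coset representatives on the left to representatives on the right. After writing the
left shuffle sum as 1 plus a shifted shuffle sum times `f 0`, induction applies to the shifted
sequence, and `f 0` moves past the factors of index at least 2. The braid relations are not used. -/
theorem symSum_succ_eq_mul_coshuffleSum (f : ℕ → R) (n : ℕ)
    (h : ∀ i j, Commute (f i) (f (i + j + 2))) :
    symSum f (n + 1) = symSum (fun i => f (i + 1)) n * coshuffleSum f (n + 1) := by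
  induction n generalizing f with
  | zero => simp [symSum, shuffleSum, coshuffleSum, descProd, Finset.sum_range_succ]
  | succ n ih =>
    have h1 := ih (fun i => f (i + 1)) fun i j => by
      simpa only [add_right_comm _ _ 1] using h (i + 1) j
    have h2 : Commute (f 0) (symSum (fun i => f (i + 1 + 1)) n) :=
      commute_symSum (fun i => by simpa only [zero_add] using h 0 i) n
    rw [coshuffleSum, symSum, shuffleSum_succ, add_mul, one_mul, mul_add, mul_one]
    congr 1
    conv_lhs => rw [h1, mul_assoc, ← mul_assoc (f 0), h2.eq]
    conv_rhs => rw [symSum]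
    simp only [mul_assoc]

theorem prod_map_descWord (f : ℕ → R) {n : ℕ} (p : Fin (n + 1)) :
    ((descWord p).map fun i : Fin n => f i).prod = descProd f p := by
  induction p using Fin.induction with
  | zero => simp [descWord, descProd]
  | succ i ih =>
    have : descWord i.succ = i :: descWord i.castSucc := by simp [descWord]
    rw [this, List.map_cons, List.prod_cons, ih, Fin.val_succ, descProd, Fin.val_castSucc]

/-- The factorization of a permutation used in `reducedWord`. -/
def permDecompose (n : ℕ) :
    Equiv.Perm (Fin (n + 2)) ≃ Fin (n + 2) × Equiv.Perm (Fin (n + 1)) where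
  toFun w := (w 0, (Equiv.Perm.decomposeFin ((w 0).cycleRange * w)).2)
  invFun q := q.1.cycleRange⁻¹ * Equiv.Perm.decomposeFin.symm (0, q.2)
  left_inv w := by
    set g := (w 0).cycleRange * w with hg
    have h0 : g 0 = 0 := by simp [hg]
    have h1 : (Equiv.Perm.decomposeFin g).1 = 0 := by
      have := Equiv.Perm.decomposeFin_symm_apply_zero (Equiv.Perm.decomposeFin g).1
        (Equiv.Perm.decomposeFin g).2
      rw [Prod.mk.eta, Equiv.symm_apply_apply, h0] at this
      exact this.symm
    have h2 : Equiv.Perm.decomposeFin.symm (0, (Equiv.Perm.decomposeFin g).2) = g := by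
      rw [← h1, Prod.mk.eta, Equiv.symm_apply_apply]
    exact (congrArg _ h2).trans (inv_mul_cancel_left _ _)
  right_inv q := by
    obtain ⟨p, e⟩ := q
    have h0 : (p.cycleRange⁻¹ * Equiv.Perm.decomposeFin.symm (0, e)) 0 = p := by
      simp [Equiv.Perm.inv_def]
    refine Prod.ext h0 ?_
    dsimp only
    rw [h0, mul_inv_cancel_left, Equiv.apply_symm_apply]

/-- Under the bijection w ↔ (w 0, v), the chosen reduced word is a descending word followed by the
shifted word of v, so the sum over w is a product of two sums. -/
theorem sum_prod_reducedWord (f : ℕ → R) (n : ℕ) :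
    ∑ w : Equiv.Perm (Fin (n + 1)), ((reducedWord n w).map fun i : Fin n => f i).prod =
      symSum f n := by
  induction n generalizing f with
  | zero =>
    have : Unique (Equiv.Perm (Fin (0 + 1))) := inferInstanceAs (Unique (Equiv.Perm (Fin 1)))
    rw [Fintype.sum_unique]
    rfl
  | succ n ih =>
    rw [symSum, ← ih, shuffleSum, ← Fin.sum_univ_eq_sum_range, Finset.sum_mul_sum,
      ← Fintype.sum_prod_type', ← (permDecompose n).sum_comp]
    refine Finset.sum_congr rfl fun w _ => ?_
    simp only [reducedWord, List.map_append, List.prod_append, prod_map_descWord, List.map_map]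
    rfl

end Ring

/-! ### The operators ψ_i on tensors with a distinguished first factor -/

variable {K M : Type*} [Field K] [AddCommGroup M] [Module K M]

/-- The bilinear map `(v, t) ↦ v ⊗ t`. -/
noncomputable def consTensor (n : ℕ) : M →ₗ[K] (⨂[K]^n M) →ₗ[K] ⨂[K]^(n + 1) M :=
  (PiTensorProduct.lift (R := K) (s := fun _ : Fin n => M)).toLinearMap ∘ₗ
    (PiTensorProduct.tprod K (s := fun _ : Fin (n + 1) => M)).curryLeft

theorem consTensor_tprod {n : ℕ} (v : M) (x : Fin n → M) :
    consTensor (K := K) n v (PiTensorProduct.tprod K x) =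
      PiTensorProduct.tprod K (Fin.cons v x : Fin (n + 1) → M) := by
  simp [consTensor]

theorem consTensor_hom_ext {n : ℕ} {E : Type*} [AddCommGroup E] [Module K E]
    {f g : (⨂[K]^(n + 1) M) →ₗ[K] E}
    (h : ∀ v x, f (consTensor n v x) = g (consTensor n v x)) : f = g := by
  refine PiTensorProduct.ext (MultilinearMap.ext fun x => ?_)
  have := h (x 0) (PiTensorProduct.tprod K (Fin.tail x))
  rwa [consTensor_tprod, Fin.cons_self_tail] at this

/-- The bilinear map `(a ⊗ b, t) ↦ a ⊗ b ⊗ t`. -/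
noncomputable def consTensorTwo (n : ℕ) :
    M ⊗[K] M →ₗ[K] (⨂[K]^n M) →ₗ[K] ⨂[K]^(n + 2) M :=
  TensorProduct.lift <| LinearMap.mk₂ K (fun a b => consTensor (n + 1) a ∘ₗ consTensor n b)
    (fun a a' b => by rw [map_add, LinearMap.add_comp])
    (fun c a b => by rw [map_smul, LinearMap.smul_comp])
    (fun a b b' => by rw [map_add, LinearMap.comp_add])
    (fun c a b => by rw [map_smul, LinearMap.comp_smul])

theorem consTensorTwo_tmul {n : ℕ} (a b : M) (t : ⨂[K]^n M) :
    consTensorTwo n (a ⊗ₜ b) t = consTensor (n + 1) a (consTensor n b t) := rfl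

variable (ψ : M ⊗[K] M →ₗ[K] M ⊗[K] M)

theorem braidAt_zero_consTensor {n : ℕ} (u v : M) (t : ⨂[K]^n M) :
    braidAt ψ (0 : Fin (n + 1)) (consTensor (n + 1) u (consTensor n v t)) =
      consTensorTwo n (ψ (u ⊗ₜ v)) t := by
  suffices h : braidAt ψ (0 : Fin (n + 1)) ∘ₗ consTensor (n + 1) u ∘ₗ consTensor n v =
      consTensorTwo n (ψ (u ⊗ₜ v)) from LinearMap.congr_fun h t
  refine PiTensorProduct.ext (MultilinearMap.ext fun x => ?_)
  have key : (insertPair (K := K) (Fin.cons u (Fin.cons v x : Fin (n + 1) → M) :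
      Fin (n + 2) → M) 0) =
      (LinearMap.applyₗ (PiTensorProduct.tprod K x)) ∘ₗ consTensorTwo n := by
    refine TensorProduct.ext' fun a b => ?_
    rw [insertPair_tmul, LinearMap.comp_apply, LinearMap.applyₗ_apply_apply, consTensorTwo_tmul,
      consTensor_tprod, consTensor_tprod]
    congr 1
    ext j
    refine Fin.cases ?_ (fun j => ?_) j
    · simp
    refine Fin.cases ?_ (fun j => ?_) j
    · simp
    · rw [Function.update_of_ne, Function.update_of_ne] <;> simp [Fin.ext_iff]
  simp only [LinearMap.compMultilinearMap_apply, LinearMap.comp_apply, consTensor_tprod,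
    braidAt_tprod, key, LinearMap.applyₗ_apply_apply]
  rfl

theorem braidAt_succ_consTensor {n : ℕ} (i : Fin n) (v : M) (t : ⨂[K]^(n + 1) M) :
    braidAt ψ i.succ (consTensor (n + 1) v t) = consTensor (n + 1) v (braidAt ψ i t) := by
  suffices h : braidAt ψ i.succ ∘ₗ consTensor (n + 1) v = consTensor (n + 1) v ∘ₗ braidAt ψ i from
    LinearMap.congr_fun h t
  refine PiTensorProduct.ext (MultilinearMap.ext fun x => ?_)
  have key : insertPair (K := K) (Fin.cons v x : Fin (n + 2) → M) i.succ =
      consTensor (n + 1) v ∘ₗ insertPair x i := by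
    refine TensorProduct.ext' fun a b => ?_
    rw [insertPair_tmul, LinearMap.comp_apply, insertPair_tmul, consTensor_tprod, Fin.cons_update,
      Fin.cons_update, Fin.succ_castSucc]
  simp only [LinearMap.compMultilinearMap_apply, LinearMap.comp_apply, consTensor_tprod,
    braidAt_tprod, key]
  rfl

/-- The endomorphism `ψ_i` of `M^{⊗ (n + 1)}` for `i < n`, and the identity for other `i`. -/
noncomputable def braidNat (n i : ℕ) : Module.End K (⨂[K]^(n + 1) M) :=
  if h : i < n then braidAt ψ ⟨i, h⟩ else 1

theorem braidNat_succ_consTensor (n i : ℕ) (v : M) (t : ⨂[K]^(n + 1) M) :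
    braidNat ψ (n + 1) (i + 1) (consTensor (n + 1) v t) =
      consTensor (n + 1) v (braidNat ψ n i t) := by
  by_cases h : i < n
  · rw [braidNat, dif_pos (Nat.succ_lt_succ h), braidNat, dif_pos h]
    exact braidAt_succ_consTensor ψ ⟨i, h⟩ v t
  · rw [braidNat, dif_neg (by omega), braidNat, dif_neg h]
    rfl

theorem braidNat_zero_consTensor (n : ℕ) (u v : M) (t : ⨂[K]^n M) :
    braidNat ψ (n + 1) 0 (consTensor (n + 1) u (consTensor n v t)) =
      consTensorTwo n (ψ (u ⊗ₜ v)) t := by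
  rw [braidNat, dif_pos (Nat.succ_pos n)]
  exact braidAt_zero_consTensor ψ u v t

theorem braidNat_add_two_consTensorTwo (n i : ℕ) (z : M ⊗[K] M) (t : ⨂[K]^(n + 1) M) :
    braidNat ψ (n + 2) (i + 2) (consTensorTwo (n + 1) z t) =
      consTensorTwo (n + 1) z (braidNat ψ n i t) := by
  induction z using TensorProduct.induction_on with
  | zero => simp
  | tmul a b =>
    rw [consTensorTwo_tmul, consTensorTwo_tmul, braidNat_succ_consTensor, braidNat_succ_consTensor]
  | add a b ha hb => simp only [map_add, LinearMap.add_apply, ha, hb]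

/-- ψ_i and ψ_{i+j+2} act on disjoint pairs of factors. Stripping first factors reduces to i = 0,
where two factors are split off and the second operator acts on the rest. -/
theorem commute_braidNat (n i j : ℕ) :
    Commute (braidNat ψ n i) (braidNat ψ n (i + j + 2)) := by
  induction n generalizing i j with
  | zero => exact Commute.one_left _
  | succ n ih =>
    refine consTensor_hom_ext fun v t => ?_
    rw [Module.End.mul_apply, Module.End.mul_apply]
    cases i with
    | succ i =>
      rw [show i + 1 + j + 2 = i + j + 2 + 1 by ring]
      simp only [braidNat_succ_consTensor]
      exact congrArg _ (LinearMap.congr_fun (ih i j) t)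
    | zero =>
      cases n with
      -- There are only two tensor factors here, so the operator with index `0 + j + 2` is the
      -- identity by default.
      | zero => rfl
      | succ n =>
        suffices h : (braidNat ψ (n + 2) 0 * braidNat ψ (n + 2) (0 + j + 2)) ∘ₗ
            consTensor (n + 2) v = (braidNat ψ (n + 2) (0 + j + 2) * braidNat ψ (n + 2) 0) ∘ₗ
            consTensor (n + 2) v from LinearMap.congr_fun h t
        refine consTensor_hom_ext fun u s => ?_
        simp only [LinearMap.comp_apply, Module.End.mul_apply, zero_add, braidNat_succ_consTensor,
          braidNat_zero_consTensor, braidNat_add_two_consTensorTwo]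

theorem symmetrizer_eq_symSum (n : ℕ) :
    symmetrizer ψ (n + 1) = symSum (braidNat ψ n) n := by
  rw [← sum_prod_reducedWord, symmetrizer]
  refine Finset.sum_congr rfl fun w _ => ?_
  rw [braidPerm]
  congr 2
  funext i
  rw [braidNat, dif_pos i.2]

/-- Identifies the left factor of the factorization with id ⊗ σ_n. The offset `k` is there because
each step of the recursion for `symSum` shifts the sequence. -/
theorem symSum_braidNat_succ_consTensor (n : ℕ) (v : M) (t : ⨂[K]^(n + 1) M) (m : ℕ) (k : ℕ) :
    symSum (fun i => braidNat ψ (n + 1) (i + k + 1)) m (consTensor (n + 1) v t) =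
      consTensor (n + 1) v (symSum (fun i => braidNat ψ n (i + k)) m t) := by
  induction m generalizing t k with
  | zero => rfl
  | succ m ih =>
    have hD : ∀ p s, descProd (fun i => braidNat ψ (n + 1) (i + k + 1)) p (consTensor (n + 1) v s) =
        consTensor (n + 1) v (descProd (fun i => braidNat ψ n (i + k)) p s) := by
      intro p
      induction p with
      | zero => exact fun s => rfl
      | succ p ihp =>
        intro s
        simp only [descProd, Module.End.mul_apply, ihp, braidNat_succ_consTensor]
    have ih' := ih t (k + 1)
    simp only [symSum, Module.End.mul_apply, shuffleSum, LinearMap.sum_apply, map_sum,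
      add_right_comm _ 1 k] at ih' ⊢
    simp only [← add_assoc] at ih'
    simp only [ih', hD]

theorem coshuffleSum_braidNat_succ_consTensor (n : ℕ) (v : M) (t : ⨂[K]^(n + 1) M) (m k : ℕ) :
    coshuffleSum (fun i => braidNat ψ (n + 1) (i + k + 1)) m (consTensor (n + 1) v t) =
      consTensor (n + 1) v (coshuffleSum (fun i => braidNat ψ n (i + k)) m t) := by
  induction m generalizing t k with
  | zero => rfl
  | succ m ih =>
    have ih' := ih t (k + 1)
    simp only [coshuffleSum, Module.End.mul_apply, LinearMap.add_apply, Module.End.one_apply,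
      map_add, add_right_comm _ 1 k, zero_add] at ih' ⊢
    simp only [← add_assoc] at ih'
    simp only [ih', braidNat_succ_consTensor]

end Symmetrizer

/-! ### The symmetrizer on words of homogeneous elements -/

section Words

/-- The order embedding of `ℕ` which omits the value `p`. -/
def skip (p i : ℕ) : ℕ := if i < p then i else i + 1

/-- The product `g_0 g_1 ⋯ g_{p-1}`. -/
def prefixProd {G : Type*} [Monoid G] (g : ℕ → G) (p : ℕ) : G := ((List.range p).map g).prod

theorem prefixProd_zero {G : Type*} [Monoid G] (g : ℕ → G) : prefixProd g 0 = 1 := rfl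

theorem prefixProd_succ {G : Type*} [Monoid G] (g : ℕ → G) (p : ℕ) :
    prefixProd g (p + 1) = prefixProd g p * g p := List.prod_range_succ g p

theorem prefixProd_succ' {G : Type*} [Monoid G] (g : ℕ → G) (p : ℕ) :
    prefixProd g (p + 1) = g 0 * prefixProd (fun i => g (i + 1)) p := List.prod_range_succ' g p

variable {K M : Type*} [Field K] [AddCommGroup M] [Module K M]

/-- The tensor `x_0 ⊗ x_1 ⊗ ⋯ ⊗ x_{n-1}`. -/
noncomputable def wordTensor (K : Type*) [Field K] [Module K M] (n : ℕ) (x : ℕ → M) : ⨂[K]^n M :=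
  PiTensorProduct.tprod K fun i : Fin n => x i

theorem wordTensor_congr {n : ℕ} {x y : ℕ → M} (h : ∀ i < n, x i = y i) :
    wordTensor K n x = wordTensor K n y :=
  congrArg (PiTensorProduct.tprod K) (funext fun i : Fin n => h i i.2)

theorem wordTensor_succ (n : ℕ) (x : ℕ → M) :
    wordTensor K (n + 1) x = consTensor n (x 0) (wordTensor K n fun i => x (i + 1)) := by
  rw [wordTensor, wordTensor, consTensor_tprod]
  congr 1
  ext i
  refine Fin.cases ?_ (fun j => ?_) i <;> simp

variable {Γ : Type*} [Group Γ] (Y : YetterDrinfeldModule K Γ M)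

/-- The operator ψ_0⋯ψ_{p-1} moves the letter x_p to the front; crossing x_{p-1}, …, x_0 in turn it
is acted on by their degrees. -/
theorem coshuffleSum_wordTensor (n : ℕ) (x : ℕ → M) (g : ℕ → Γ)
    (hx : ∀ i, x i ∈ Y.component (g i)) :
    coshuffleSum (braidNat Y.braiding n) n (wordTensor K (n + 1) x) =
      ∑ p ∈ Finset.range (n + 1), consTensor n (Y.ρ (prefixProd g p) (x p))
        (wordTensor K n fun i => x (skip p i)) := by
  induction n generalizing x g with
  | zero =>
    rw [Finset.sum_range_one, prefixProd_zero, map_one, wordTensor_succ]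
    rfl
  | succ n ih =>
    rw [coshuffleSum, LinearMap.add_apply, Module.End.mul_apply, Finset.sum_range_succ',
      wordTensor_succ (n + 1)]
    refine (add_comm _ _).trans ?_
    have h1 := coshuffleSum_braidNat_succ_consTensor Y.braiding n (x 0)
      (wordTensor K (n + 1) fun i => x (i + 1)) n 0
    simp only [add_zero] at h1
    rw [h1, ih (fun i => x (i + 1)) (fun i => g (i + 1)) (fun i => hx _), map_sum, map_sum]
    congr 1
    · refine Finset.sum_congr rfl fun p _ => ?_
      rw [braidNat_zero_consTensor, Y.braiding_tmul (hx 0), consTensorTwo_tmul, prefixProd_succ',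
        map_mul, wordTensor_succ n, Module.End.mul_apply]
      congr 3
      funext i
      simp only [skip, Nat.succ_lt_succ_iff]
      split_ifs <;> rfl
    · rw [prefixProd_zero, map_one]
      rfl

theorem symmetrizer_wordTensor (n : ℕ) (x : ℕ → M) (g : ℕ → Γ)
    (hx : ∀ i, x i ∈ Y.component (g i)) :
    symmetrizer Y.braiding (n + 2) (wordTensor K (n + 2) x) =
      ∑ p ∈ Finset.range (n + 2), consTensor (n + 1) (Y.ρ (prefixProd g p) (x p))
        (symmetrizer Y.braiding (n + 1) (wordTensor K (n + 1) fun i => x (skip p i))) := by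
  rw [symmetrizer_eq_symSum, symmetrizer_eq_symSum,
    symSum_succ_eq_mul_coshuffleSum _ _ (commute_braidNat Y.braiding (n + 1)),
    Module.End.mul_apply, coshuffleSum_wordTensor Y _ x g hx, map_sum]
  exact Finset.sum_congr rfl fun p _ =>
    symSum_braidNat_succ_consTensor Y.braiding n _ _ n 0

/-- In the recursion, omitting x_j or x_{j+1} leaves the same word, while the front letters differ
by the action of g_j, that is, by a sign. Any other omission keeps the repeated pair. -/
theorem symmetrizer_wordTensor_eq_zero (n : ℕ) (x : ℕ → M) (g : ℕ → Γ)
    (hx : ∀ i, x i ∈ Y.component (g i)) (j : ℕ) (hj : j + 1 < n) (hxj : x (j + 1) = x j)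
    (hρ : Y.ρ (g j) (x j) = -x j) :
    symmetrizer Y.braiding n (wordTensor K n x) = 0 := by
  induction n generalizing x g j with
  | zero => omega
  | succ n ih =>
    obtain _ | n := n
    · omega
    rw [symmetrizer_wordTensor Y n x g hx]
    rw [← Finset.sum_subset (s₁ := {j, j + 1}), Finset.sum_pair (by omega)]
    · have h1 : wordTensor K (n + 1) (fun i => x (skip (j + 1) i)) =
          wordTensor K (n + 1) fun i => x (skip j i) := by
        refine wordTensor_congr fun i _ => ?_
        simp only [skip]
        rcases lt_trichotomy i j with h | rfl | h
        · rw [if_pos h, if_pos (by omega)]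
        · rw [if_pos (by omega), if_neg (by omega), hxj]
        · rw [if_neg (by omega), if_neg (by omega)]
      rw [h1, prefixProd_succ, map_mul, Module.End.mul_apply, hxj, hρ, map_neg, map_neg,
        LinearMap.neg_apply, add_neg_cancel]
    · intro p
      simp only [Finset.mem_insert, Finset.mem_singleton, Finset.mem_range]
      omega
    · intro p hp hpj
      simp only [Finset.mem_insert, Finset.mem_singleton, Finset.mem_range, not_or] at hp hpj
      -- Omitting a letter before the pair moves the pair to positions j - 1 and j; omitting one
      -- after it leaves the pair in place.
      rcases lt_or_gt_of_ne hpj.1 with h | h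
      · obtain _ | j := j
        · omega
        have e1 : skip p j = j + 1 := by simp only [skip]; rw [if_neg (by omega)]
        have e2 : skip p (j + 1) = j + 1 + 1 := by simp only [skip]; rw [if_neg (by omega)]
        rw [ih (fun i => x (skip p i)) (fun i => g (skip p i)) (fun i => hx _) j (by omega)
          (by rw [e1, e2, hxj]) (by rw [e1, hρ]), map_zero]
      · have e1 : skip p j = j := by simp only [skip]; rw [if_pos (by omega)]
        have e2 : skip p (j + 1) = j + 1 := by simp only [skip]; rw [if_pos (by omega)]
        rw [ih (fun i => x (skip p i)) (fun i => g (skip p i)) (fun i => hx _) j (by omega)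
          (by rw [e1, e2, hxj]) (by rw [e1, hρ]), map_zero]

end Words

/-! ### Alternating words and braid relations in a Nichols algebra -/

section Alternating

/-- The alternating sequence `x, y, x, y, …`. -/
def altSeq {X : Type*} (x y : X) (i : ℕ) : X := if Even i then x else y

theorem altSeq_succ {X : Type*} (x y : X) (i : ℕ) : altSeq x y (i + 1) = altSeq y x i := by
  simp only [altSeq, Nat.even_add_one]
  split_ifs <;> rfl

theorem map_altSeq {X Z : Type*} (f : X → Z) (x y : X) (i : ℕ) :
    f (altSeq x y i) = altSeq (f x) (f y) i := apply_ite f _ _ _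

theorem altProd_succ {A : Type*} [Monoid A] (x y : A) (m : ℕ) :
    altProd x y (m + 1) = x * altProd y x m := by
  have h : ∀ k : ℕ, (x * y) ^ k * x = x * (y * x) ^ k := fun k =>
    ((SemiconjBy.pow_right (show SemiconjBy x (y * x) (x * y) from (mul_assoc _ _ _).symm) k)).symm
  rcases Nat.even_or_odd' m with ⟨k, rfl | rfl⟩
  · have h1 : (2 * k + 1) / 2 = k := by omega
    have h2 : (2 * k) / 2 = k := by omega
    simp only [altProd, h1, h2, Nat.mul_add_mod_self_left, Nat.mul_mod_right, pow_zero, mul_one]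
    simpa using h k
  · have h1 : (2 * k + 1 + 1) / 2 = k + 1 := by omega
    have h2 : (2 * k + 1) / 2 = k := by omega
    have h3 : (2 * k + 1 + 1) % 2 = 0 := by omega
    have h4 : (2 * k + 1) % 2 = 1 := by omega
    simp only [altProd, h1, h2, h3, h4, pow_zero, mul_one, pow_one]
    rw [pow_succ, ← mul_assoc, h k, mul_assoc]

theorem prefixProd_altSeq {A : Type*} [Monoid A] (x y : A) (m : ℕ) :
    prefixProd (altSeq x y) m = altProd x y m := by
  induction m generalizing x y with
  | zero => simp [prefixProd, altProd]
  | succ m ih =>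
    rw [prefixProd_succ', altProd_succ, ← ih]
    simp only [altSeq_succ]
    rfl

theorem prefixProd_eq_prod_ofFn {A : Type*} [Monoid A] (x : ℕ → A) (m : ℕ) :
    prefixProd x m = (List.ofFn fun i : Fin m => x i).prod := by
  induction m generalizing x with
  | zero => rfl
  | succ m ih => rw [prefixProd_succ', ih, List.ofFn_succ, List.prod_cons]; rfl

variable {K M Γ : Type*} [Field K] [AddCommGroup M] [Module K M] [Group Γ]
  (Y : YetterDrinfeldModule K Γ M)

theorem mkAlgHom_wordTensor (ψ : M ⊗[K] M →ₗ[K] M ⊗[K] M) (n : ℕ) (x : ℕ → M) :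
    RingQuot.mkAlgHom K (NicholsRel ψ) (TensorPower.toTensorAlgebra (wordTensor K n x)) =
      prefixProd (fun i => NicholsAlgebra.ι ψ (x i)) n := by
  rw [wordTensor, TensorPower.toTensorAlgebra_tprod, TensorAlgebra.tprod_apply, map_list_prod,
    List.map_ofFn, prefixProd_eq_prod_ofFn]
  rfl

/-- σ_2(a ⊗ a) = a ⊗ a + s(a) ⊗ a = 0. -/
theorem NicholsAlgebra.ι_mul_self {a : M} {s : Γ} (ha : a ∈ Y.component s)
    (hsa : Y.ρ s a = -a) :
    NicholsAlgebra.ι Y.braiding a * NicholsAlgebra.ι Y.braiding a = 0 := by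
  have h := RingQuot.mkAlgHom_rel K (NicholsRel.of (ψ := Y.braiding) 2 _
    (symmetrizer_wordTensor_eq_zero Y 2 (fun _ => a) (fun _ => s) (fun _ => ha) 0 (by omega) rfl
      hsa))
  rw [mkAlgHom_wordTensor, map_zero] at h
  simpa [prefixProd, List.range_succ] using h

/-- Omitting an inner letter makes its two equal neighbours adjacent, so only the first and last
letters contribute. The hypothesis `h` says that the last letter arrives at the front as b, with no
sign. -/
theorem symmetrizer_wordTensor_altSeq {a b : M} {s t : Γ} (ha : a ∈ Y.component s)
    (hb : b ∈ Y.component t) (hsa : Y.ρ s a = -a) (htb : Y.ρ t b = -b) (n : ℕ)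
    (h : Y.ρ (altProd s t (n + 1)) (altSeq a b (n + 1)) = b) :
    symmetrizer Y.braiding (n + 2) (wordTensor K (n + 2) (altSeq a b)) =
      consTensor (n + 1) a
        (symmetrizer Y.braiding (n + 1) (wordTensor K (n + 1) (altSeq b a))) +
      consTensor (n + 1) b
        (symmetrizer Y.braiding (n + 1) (wordTensor K (n + 1) (altSeq a b))) := by
  have hx : ∀ i, altSeq a b i ∈ Y.component (altSeq s t i) := fun i => by
    simp only [altSeq]
    split_ifs
    exacts [ha, hb]
  have hρ : ∀ i, Y.ρ (altSeq s t i) (altSeq a b i) = -altSeq a b i := fun i => by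
    simp only [altSeq]
    split_ifs
    exacts [hsa, htb]
  rw [symmetrizer_wordTensor Y n _ _ hx, ← Finset.sum_subset (s₁ := {0, n + 1}),
    Finset.sum_pair (by omega), prefixProd_zero, map_one, prefixProd_altSeq, h]
  · congr 1
    · simp only [skip, Nat.not_lt_zero, if_false, altSeq_succ]
      rfl
    · refine congrArg _ (congrArg _ (wordTensor_congr fun i hi => ?_))
      simp only [skip, if_pos hi]
  · intro p
    simp only [Finset.mem_insert, Finset.mem_singleton, Finset.mem_range]
    omega
  · intro p hp hpj
    simp only [Finset.mem_insert, Finset.mem_singleton, Finset.mem_range, not_or] at hp hpj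
    obtain _ | p := p
    · omega
    have e1 : skip (p + 1) p = p := by simp only [skip]; rw [if_pos (by omega)]
    have e2 : skip (p + 1) (p + 1) = p + 2 := by simp only [skip]; rw [if_neg (by omega)]
    rw [symmetrizer_wordTensor_eq_zero Y (n + 1) (fun i => altSeq a b (skip (p + 1) i))
      (fun i => altSeq s t (skip (p + 1) i)) (fun i => hx _) p (by omega)
      (by rw [e1, e2, altSeq_succ, altSeq_succ]) (by rw [e1, hρ]), map_zero]

theorem NicholsAlgebra.altProd_ι_eq {a b : M} {s t : Γ} (ha : a ∈ Y.component s)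
    (hb : b ∈ Y.component t) (hsa : Y.ρ s a = -a) (htb : Y.ρ t b = -b) (n : ℕ)
    (hab : Y.ρ (altProd s t (n + 1)) (altSeq a b (n + 1)) = b)
    (hba : Y.ρ (altProd t s (n + 1)) (altSeq b a (n + 1)) = a) :
    altProd (NicholsAlgebra.ι Y.braiding a) (NicholsAlgebra.ι Y.braiding b) (n + 2) =
      altProd (NicholsAlgebra.ι Y.braiding b) (NicholsAlgebra.ι Y.braiding a) (n + 2) := by
  have h := RingQuot.mkAlgHom_rel K (NicholsRel.of (ψ := Y.braiding) (n + 2)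
    (wordTensor K (n + 2) (altSeq a b) - wordTensor K (n + 2) (altSeq b a)) (by
      -- The expansions of the two alternating words have the same two summands in opposite order.
      rw [map_sub, symmetrizer_wordTensor_altSeq Y ha hb hsa htb n hab,
        symmetrizer_wordTensor_altSeq Y hb ha htb hsa n hba, sub_eq_zero]
      exact add_comm _ _))
  rw [map_sub, map_sub, mkAlgHom_wordTensor, mkAlgHom_wordTensor, map_zero, sub_eq_zero] at h
  simpa only [map_altSeq, prefixProd_altSeq] using h

end Alternating

/-! ### Pairs of affine reflections -/

section RankTwo

/-- Since ts is the inverse of st, moving one side of the braid relation to the other gives the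
power m of st. -/
theorem pow_eq_one_of_altProd_eq {G : Type*} [Group G] {s t : G} (hs : s * s = 1) (ht : t * t = 1)
    {m : ℕ} (h : altProd s t m = altProd t s m) : (s * t) ^ m = 1 := by
  have hts : t * s = (s * t)⁻¹ := by
    rw [mul_inv_rev, inv_eq_of_mul_eq_one_left hs, inv_eq_of_mul_eq_one_left ht]
  rcases Nat.even_or_odd' m with ⟨k, rfl | rfl⟩
  · have h2 : (2 * k) / 2 = k := by omega
    simp only [altProd, h2, Nat.mul_mod_right, pow_zero, mul_one] at h
    rw [two_mul, pow_add]
    nth_rw 1 [h]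
    rw [hts, inv_pow, inv_mul_cancel]
  · have h2 : (2 * k + 1) / 2 = k := by omega
    have h4 : (2 * k + 1) % 2 = 1 := by omega
    simp only [altProd, h2, h4, pow_one] at h
    rw [show 2 * k + 1 = k + 1 + k by ring, pow_add, pow_succ, ← mul_assoc, h, mul_assoc _ t t, ht,
      mul_one, hts, inv_pow, inv_mul_cancel]

variable {ι V V' : Type*} [AddCommGroup V] [Module ℚ V] [AddCommGroup V'] [Module ℚ V']
  (P : RootPairing ι ℚ V V')

theorem affineReflection_mul_self (a : ι × ℤ) :
    affineReflection P a * affineReflection P a = 1 := by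
  ext1
  · apply Multiplicative.toAdd.injective
    apply Subtype.ext
    change (a.2 • P.coroot a.1 : V') + corootAct P (RootPairing.weylGroup.ofIdx P a.1 : P.Aut)
      (a.2 • P.coroot a.1) = 0
    rw [map_zsmul, corootAct_coroot, ← smul_add]
    change a.2 • (P.coroot a.1 + P.coroot (P.reflectionPerm a.1 a.1)) = 0
    simp
  · apply Subtype.ext
    apply RootPairing.Equiv.weightHom_injective
    ext v
    change P.reflection a.1 (P.reflection a.1 v) = v
    exact P.reflection_same a.1 v

/-- The affine function `α - k` attached to the pair `(α, k)`. -/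
def affineCoord (a : ι × ℤ) : V × ℚ := (P.root a.1, a.2)

theorem affineCoord_injective : Function.Injective (affineCoord P) := by
  rintro ⟨i, k⟩ ⟨j, l⟩ h
  obtain ⟨h1, h2⟩ := Prod.mk.inj h
  exact Prod.ext (P.root.injective h1) (Int.cast_injective h2)

/-- The linear action of the affine reflection `s_{α,k}` on affine functions. -/
noncomputable def affineReflectionMap (a : ι × ℤ) : V × ℚ →ₗ[ℚ] V × ℚ :=
  LinearMap.id - (P.coroot' a.1 ∘ₗ LinearMap.fst ℚ V ℚ).smulRight (affineCoord P a)

variable [P.IsCrystallographic]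

/-- Linearizes the action of reflections on pairs (α, k), so that identities between pairs can be
checked by linear algebra with Cartan integers. -/
theorem affineCoord_affineAct (a c : ι × ℤ) :
    affineCoord P (affineAct P (affineReflection P a) c) =
      affineReflectionMap P a (affineCoord P c) := by
  refine Prod.ext ?_ ?_
  · change P.root (P.reflectionPerm a.1 c.1) = _
    rw [P.root_reflectionPerm]
    simp [affineReflectionMap, affineCoord, P.reflection_apply]
  · change ((c.2 + P.root'In ℤ (P.reflectionPerm a.1 c.1)
      (a.2 • P.corootSpanMem ℤ a.1) : ℤ) : ℚ) = _
    rw [Int.cast_add, cast_root'In, P.root_reflectionPerm, P.reflection_apply]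
    have h : ((a.2 • P.corootSpanMem ℤ a.1 : P.corootSpan ℤ) : V') = a.2 • P.coroot a.1 := rfl
    rw [h]
    simp [affineReflectionMap, affineCoord]
    ring

theorem affineReflectionMap_affineCoord (a c : ι × ℤ) :
    affineReflectionMap P a (affineCoord P c) =
      affineCoord P c - (P.pairingIn ℤ c.1 a.1 : ℚ) • affineCoord P a := by
  have h := P.algebraMap_pairingIn ℤ c.1 a.1
  simp only [algebraMap_int_eq, eq_intCast] at h
  rw [h]
  simp [affineReflectionMap, affineCoord]

theorem affineAct_affineReflection_self (a : ι × ℤ) :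
    affineAct P (affineReflection P a) a = negAffine P a := by
  apply affineCoord_injective P
  rw [affineCoord_affineAct, affineReflectionMap_affineCoord]
  simp [affineCoord, negAffine]
  constructor
  · module
  · ring

/-- If g is the product of the first n + 1 reflections and sends the next letter x to b, then g s_x
g⁻¹ = s_b, and g s_x = s_b g is the braid relation in the group. -/
theorem altProd_affineReflection_eq {a b : ι × ℤ} (n : ℕ)
    (h : affineAct P (altProd (affineReflection P a) (affineReflection P b) (n + 1))
      (altSeq a b (n + 1)) = b) :
    altProd (affineReflection P a) (affineReflection P b) (n + 2) =
      altProd (affineReflection P b) (affineReflection P a) (n + 2) := by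
  have h1 := mul_affineReflection P
    (altProd (affineReflection P a) (affineReflection P b) (n + 1)) (altSeq a b (n + 1))
  rw [h, mul_inv_eq_iff_eq_mul, map_altSeq (affineReflection P), ← altProd_succ,
    ← prefixProd_altSeq, ← prefixProd_succ, prefixProd_altSeq] at h1
  exact h1

/-- The six cases are the Cartan matrices of types A₁ × A₁, A₂, B₂ and G₂, the last two in both
orientations. The sign of the Cartan integers matters: for (1, 1) the word of length 3 would give -b
instead of b. -/
theorem exists_orderOf_eq_and_affineAct_altProd {a b : ι × ℤ}
    (h : (P.pairingIn ℤ a.1 b.1, P.pairingIn ℤ b.1 a.1) ∈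
      ({(0, 0), (-1, -1), (-1, -2), (-2, -1), (-1, -3), (-3, -1)} : Set (ℤ × ℤ))) :
    ∃ n : ℕ, orderOf (affineReflection P a * affineReflection P b) = n + 2 ∧
      affineAct P (altProd (affineReflection P a) (affineReflection P b) (n + 1))
        (altSeq a b (n + 1)) = b ∧
      affineAct P (altProd (affineReflection P b) (affineReflection P a) (n + 1))
        (altSeq b a (n + 1)) = a := by
  -- The first condition already gives (s_a s_b)^{n+2} = 1; the order is exact once no smaller
  -- positive power fixes b.
  have key : ∀ n : ℕ,
      affineAct P (altProd (affineReflection P a) (affineReflection P b) (n + 1))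
        (altSeq a b (n + 1)) = b →
      affineAct P (altProd (affineReflection P b) (affineReflection P a) (n + 1))
        (altSeq b a (n + 1)) = a →
      (∀ m < n + 2, 0 < m →
        affineAct P ((affineReflection P a * affineReflection P b) ^ m) b ≠ b) →
      ∃ n : ℕ, orderOf (affineReflection P a * affineReflection P b) = n + 2 ∧
      affineAct P (altProd (affineReflection P a) (affineReflection P b) (n + 1))
        (altSeq a b (n + 1)) = b ∧
      affineAct P (altProd (affineReflection P b) (affineReflection P a) (n + 1))
        (altSeq b a (n + 1)) = a := fun n h1 h2 h3 =>
    ⟨n, (orderOf_eq_iff (by omega)).mpr ⟨pow_eq_one_of_altProd_eq (affineReflection_mul_self P a)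
      (affineReflection_mul_self P b) (altProd_affineReflection_eq P n h1),
      fun m hm h0 e => h3 m hm h0 (by rw [e, affineAct_one])⟩, h1, h2⟩
  have haa := affineReflectionMap_affineCoord P a a
  have hab := affineReflectionMap_affineCoord P a b
  have hba := affineReflectionMap_affineCoord P b a
  have hbb := affineReflectionMap_affineCoord P b b
  have e1 : P.pairingIn ℤ a.1 a.1 = 2 := P.pairingIn_same ℤ a.1
  have e2 : P.pairingIn ℤ b.1 b.1 = 2 := P.pairingIn_same ℤ b.1
  rw [e1] at haa
  rw [e2] at hbb
  have pb : ∀ c, P.coroot' b.1 (affineCoord P c).1 = P.pairingIn ℤ c.1 b.1 := fun c => by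
    have h := P.algebraMap_pairingIn ℤ c.1 b.1
    simp only [algebraMap_int_eq, eq_intCast] at h
    simp [h, affineCoord]
  -- A power fixing b sends its root to a root with pairing 2 against the coroot of b, a numerical
  -- condition that can be refuted.
  have hneg : ∀ m : ℕ, affineAct P ((affineReflection P a * affineReflection P b) ^ m) b = b →
      P.coroot' b.1 (((affineReflectionMap P a * affineReflectionMap P b) ^ m)
        (affineCoord P b)).1 = 2 := by
    intro m e
    have : ∀ c, affineCoord P (affineAct P ((affineReflection P a * affineReflection P b) ^ m) c) =
        ((affineReflectionMap P a * affineReflectionMap P b) ^ m) (affineCoord P c) := by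
      clear e
      induction m with
      | zero => simp [affineAct_one]
      | succ m ih =>
        intro c
        simp only [pow_succ, affineAct_mul, ih, affineCoord_affineAct, Module.End.mul_apply]
    rw [← this, e, pb, e2]; rfl
  simp only [Set.mem_insert_iff, Set.mem_singleton_iff, Prod.mk.injEq] at h
  have pba := pb a
  have pbb := pb b
  rw [e2] at pbb
  -- The orders are n + 2 = 2, 3, 4, 4, 6, 6.
  rcases h with ⟨h1, h2⟩ | ⟨h1, h2⟩ | ⟨h1, h2⟩ | ⟨h1, h2⟩ | ⟨h1, h2⟩ | ⟨h1, h2⟩ <;>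
    rw [h2] at hab <;> rw [h1] at hba pba <;>
    [refine key 0 ?_ ?_ ?_; refine key 1 ?_ ?_ ?_; refine key 2 ?_ ?_ ?_; refine key 2 ?_ ?_ ?_;
      refine key 4 ?_ ?_ ?_; refine key 4 ?_ ?_ ?_]
  any_goals
    apply affineCoord_injective P
    simp only [altProd_succ, altSeq_succ, affineAct_mul, affineCoord_affineAct]
    simp only [altProd, altSeq, Nat.zero_div, pow_zero, Nat.zero_mod, mul_one, affineAct_one,
      Even.zero, if_true]
    simp only [map_sub, map_smul, haa, hab, hba, hbb]
    push_cast
    module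
  all_goals
    intro m hm h0 e
    have h := hneg m e
    interval_cases m <;>
    · simp only [pow_succ, pow_zero, one_mul, Module.End.mul_apply, map_sub, map_smul, haa, hab,
        hba, hbb, Prod.fst_sub, Prod.smul_fst, pba, pbb, smul_eq_mul] at h
      norm_num at h

end RankTwo

/-! ### The universal property of the crossed product -/

section Crossed

variable {K A S X : Type*} [Field K] [Ring A] [Algebra K A] [CommRing S] [Algebra K S]
  (gen : X → A) (s : X → S →ₐ[K] S) (d : X → S → S)

theorem CrossedProduct.inl_mul_inr (x : X) (f : S) :
    CrossedProduct.inl gen s d (gen x) * CrossedProduct.inr gen s d f =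
      CrossedProduct.inr gen s d (d x f) +
        CrossedProduct.inr gen s d (s x f) * CrossedProduct.inl gen s d (gen x) := by
  have h := RingQuot.mkAlgHom_rel K (CrossedRel.cross (gen := gen) (s := s) (d := d) x f)
  rw [map_mul, map_add, map_mul] at h
  exact h

variable {B : Type*} [Ring B] [Algebra K B] (u : A →ₐ[K] B) (v : S →ₐ[K] B)
  (h : ∀ x f, u (gen x) * v f = v (d x f) + v (s x f) * u (gen x))

/-- The universal property of the crossed product. -/
noncomputable def CrossedProduct.lift : CrossedProduct gen s d →ₐ[K] B :=
  RingQuot.liftAlgHom K ⟨TensorAlgebra.lift K (u.toLinearMap.coprod v.toLinearMap), by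
    intro x y hxy
    cases hxy <;> simp [h]⟩

theorem CrossedProduct.lift_inl (a : A) :
    CrossedProduct.lift gen s d u v h (CrossedProduct.inl gen s d a) = u a := by
  refine (RingQuot.liftAlgHom_mkAlgHom_apply K _ _ _).trans ?_
  simp

theorem CrossedProduct.lift_inr (f : S) :
    CrossedProduct.lift gen s d u v h (CrossedProduct.inr gen s d f) = v f := by
  refine (RingQuot.liftAlgHom_mkAlgHom_apply K _ _ _).trans ?_
  simp

end Crossed

/-! ### Nil-Coxeter relations for the affine simple roots -/

variable {ι V V' : Type*} [AddCommGroup V] [Module ℚ V] [AddCommGroup V'] [Module ℚ V']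
  {P : RootPairing ι ℚ V V'} (b : P.Base) (θ : ι)

theorem simpleReflection_eq (i : AffineNode b) :
    simpleReflection b θ i = affineReflection P (nodePair b θ i) := by
  cases i with
  -- The pair of the node 0 is (-θ, -1), the negative of (θ, 1), and defines the same reflection.
  | none => exact (affineReflection_neg P (θ, 1)).symm
  | some i => rfl

theorem nodePair_fst (i : AffineNode b) : (nodePair b θ i).1 = nodeRoot b θ i := by
  cases i <;> rfl

theorem Baf_mk_mul_self [P.IsCrystallographic] (a : ι × ℤ) : Baf.mk P a * Baf.mk P a = 0 := by
  refine NicholsAlgebra.ι_mul_self (VafYD P) (Vaf.mk_mem P a) ?_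
  refine (VafRep_mk P _ a).trans ?_
  rw [affineAct_affineReflection_self, Vaf.mk_neg]

theorem altProd_Baf_mk_eq [P.IsCrystallographic] {a c : ι × ℤ}
    (h : (P.pairingIn ℤ a.1 c.1, P.pairingIn ℤ c.1 a.1) ∈
      ({(0, 0), (-1, -1), (-1, -2), (-2, -1), (-1, -3), (-3, -1)} : Set (ℤ × ℤ))) :
    altProd (Baf.mk P a) (Baf.mk P c) (orderOf (affineReflection P a * affineReflection P c)) =
      altProd (Baf.mk P c) (Baf.mk P a)
        (orderOf (affineReflection P a * affineReflection P c)) := by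
  obtain ⟨n, hn, h1, h2⟩ := exists_orderOf_eq_and_affineAct_altProd P h
  have hself : ∀ x, (VafYD P).ρ (affineReflection P x) (Vaf.mk P x) = -Vaf.mk P x := fun x =>
    (VafRep_mk P _ x).trans (by rw [affineAct_affineReflection_self, Vaf.mk_neg])
  rw [hn]
  refine NicholsAlgebra.altProd_ι_eq (VafYD P) (Vaf.mk_mem P a) (Vaf.mk_mem P c) (hself a)
    (hself c) n ?_ ?_
  · rw [← map_altSeq (Vaf.mk P)]
    exact (VafRep_mk P _ _).trans (congrArg _ h1)
  · rw [← map_altSeq (Vaf.mk P)]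
    exact (VafRep_mk P _ _).trans (congrArg _ h2)

/-- Sums of simple roots have nonnegative coordinates in the basis of simple roots. -/
theorem neg_root_notMem_closure [P.IsRootSystem] (b : P.Base) {i : ι} (hi : i ∈ b.support) :
    -P.root i ∉ AddSubmonoid.closure (P.root '' b.support) := by
  classical
  intro h
  have key : ∀ v ∈ AddSubmonoid.closure (P.root '' b.support),
      0 ≤ b.toWeightBasis.repr v ⟨i, hi⟩ := by
    intro v hv
    induction hv using AddSubmonoid.closure_induction with
    | mem v hv =>
      obtain ⟨j, hj, rfl⟩ := hv
      rw [b.toWeightBasis_repr_root ⟨j, hj⟩, Finsupp.single_apply]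
      split_ifs <;> norm_num
    | zero => simp
    | add v w _ _ hv hw => rw [map_add]; exact add_nonneg hv hw
  have h1 := key _ h
  rw [map_neg, b.toWeightBasis_repr_root ⟨i, hi⟩] at h1
  norm_num at h1

/-- A negative pairing would make θ + α_i a root, unless θ = -α_i. Comparing θ with that root would
make -α_i a sum of simple roots; if θ = -α_i, comparing θ with α_i does the same. -/
theorem IsHighestRoot.pairingIn_nonneg [Finite ι] [P.IsRootSystem] [P.IsCrystallographic]
    {b : P.Base} {θ : ι} (hθ : IsHighestRoot b θ) {i : ι} (hi : i ∈ b.support) :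
    0 ≤ P.pairingIn ℤ θ i := by
  by_contra! h
  by_cases h' : P.root θ = -P.root i
  · refine neg_root_notMem_closure b hi ?_
    have h1 := add_mem (hθ i) (AddSubmonoid.subset_closure ⟨i, hi, rfl⟩)
    rwa [sub_add_cancel, h'] at h1
  · obtain ⟨j, hj⟩ := P.root_add_root_mem_of_pairingIn_neg h h'
    refine neg_root_notMem_closure b hi ?_
    have h1 := hθ j
    rwa [hj, sub_add_cancel_left] at h1

theorem pairingIn_mem_of_nonpos [Finite ι] [P.IsCrystallographic] [P.IsReduced] {i j : ι}
    (h : P.pairingIn ℤ i j ≤ 0) (hne : P.root i ≠ -P.root j) :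
    (P.pairingIn ℤ i j, P.pairingIn ℤ j i) ∈
      ({(0, 0), (-1, -1), (-1, -2), (-2, -1), (-1, -3), (-3, -1)} : Set (ℤ × ℤ)) := by
  have hij : P.root i ≠ P.root j := fun e => by
    rw [P.root.injective e, P.pairingIn_same] at h
    norm_num at h
  have h1 := P.pairingIn_pairingIn_mem_set_of_isCrystal_of_isRed' i j hij hne
  simp only [Set.mem_insert_iff, Set.mem_singleton_iff, Prod.mk.injEq] at h1 ⊢
  omega

theorem coxeterOrder_comm (i j : AffineNode b) : coxeterOrder b θ i j = coxeterOrder b θ j i := by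
  have h : simpleReflection b θ j * simpleReflection b θ i =
      simpleReflection b θ j * (simpleReflection b θ i * simpleReflection b θ j) *
        (simpleReflection b θ j)⁻¹ := by group
  rw [coxeterOrder, coxeterOrder, h, ← MulAut.conj_apply, MulEquiv.orderOf_eq]

/-- Here s_{θ,1} s_{θ,0} is the translation by θ^∨, which has infinite order because the coroot
space is torsion-free. -/
theorem coxeterOrder_none_some_self (hθ : θ ∈ b.support) :
    coxeterOrder b θ none (some ⟨θ, hθ⟩) = 0 := by
  have h : simpleReflection b θ none * simpleReflection b θ (some ⟨θ, hθ⟩) =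
      SemidirectProduct.inl (Multiplicative.ofAdd (P.corootSpanMem ℤ θ)) := by
    have h1 : affineReflection P (θ, 1) =
        SemidirectProduct.inl (Multiplicative.ofAdd (P.corootSpanMem ℤ θ)) *
          affineReflection P (θ, 0) := by
      ext1 <;> simp [affineReflection]
    change affineReflection P (θ, 1) * affineReflection P (θ, 0) = _
    rw [h1, mul_assoc, affineReflection_mul_self, mul_one]
  rw [coxeterOrder, h, orderOf_injective _ SemidirectProduct.inl_injective,
    orderOf_ofAdd_eq_addOrderOf, addOrderOf_eq_zero_iff']
  intro n hn h0
  have h1 : n • P.coroot θ = 0 := congrArg Subtype.val h0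
  rw [← Nat.cast_smul_eq_nsmul ℚ, smul_eq_zero] at h1
  rcases h1 with h1 | h1
  · exact hn.ne' (Nat.cast_eq_zero.mp h1)
  · exact P.ne_zero' θ h1

/-- Any two distinct nodes have nonpositive pairing, and their roots can be opposite only if one
node is 0 and the other is θ itself; `hm` excludes this case. -/
theorem altProd_Baf_mk_nodePair_eq [Finite ι] [P.IsRootSystem] [P.IsCrystallographic] [P.IsReduced]
    {b : P.Base} {θ : ι} (hθ : IsHighestRoot b θ) (i j : AffineNode b) (hij : i ≠ j)
    (hm : coxeterOrder b θ i j ≠ 0) :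
    altProd (Baf.mk P (nodePair b θ i)) (Baf.mk P (nodePair b θ j)) (coxeterOrder b θ i j) =
      altProd (Baf.mk P (nodePair b θ j)) (Baf.mk P (nodePair b θ i)) (coxeterOrder b θ i j) := by
  have key : ∀ i j : AffineNode b,
      P.pairingIn ℤ (nodePair b θ i).1 (nodePair b θ j).1 ≤ 0 →
      P.root (nodePair b θ i).1 ≠ -P.root (nodePair b θ j).1 →
      altProd (Baf.mk P (nodePair b θ i)) (Baf.mk P (nodePair b θ j)) (coxeterOrder b θ i j) =
        altProd (Baf.mk P (nodePair b θ j)) (Baf.mk P (nodePair b θ i))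
          (coxeterOrder b θ i j) := fun i j h1 h2 => by
    rw [coxeterOrder, simpleReflection_eq, simpleReflection_eq]
    exact altProd_Baf_mk_eq (pairingIn_mem_of_nonpos h1 h2)
  have keyNone : ∀ i : b.support, coxeterOrder b θ none (some i) ≠ 0 →
      altProd (Baf.mk P (nodePair b θ none)) (Baf.mk P (nodePair b θ (some i)))
        (coxeterOrder b θ none (some i)) =
      altProd (Baf.mk P (nodePair b θ (some i))) (Baf.mk P (nodePair b θ none))
        (coxeterOrder b θ none (some i)) := by
    rintro ⟨i, hi⟩ hm
    refine key none (some ⟨i, hi⟩) ?_ ?_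
    · have h1 := hθ.pairingIn_nonneg hi
      change P.pairingIn ℤ (P.reflectionPerm θ θ) i ≤ 0
      rw [P.pairingIn_reflectionPerm_self_left]
      omega
    · change P.root (P.reflectionPerm θ θ) ≠ -P.root i
      rw [P.root_reflectionPerm, P.reflection_apply_self, ne_eq, neg_inj]
      intro e
      obtain rfl := P.root.injective e
      exact hm (coxeterOrder_none_some_self b θ hi)
  cases i with
  | none =>
    cases j with
    | none => exact absurd rfl hij
    | some j => exact keyNone j hm
  | some i =>
    cases j with
    | none =>
      rw [coxeterOrder_comm] at hm ⊢
      exact (keyNone i hm).symm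
    | some j =>
      have hne : (i : ι) ≠ j := fun e => hij (congrArg some (Subtype.ext e))
      exact key _ _ (b.pairingIn_le_zero_of_ne hne i.2 j.2) (b.root_ne_neg_of_ne i.2 j.2 hne)

end AffineNilHecke

/-! ### The homomorphism from the affine nil-Hecke algebra -/

open AffineNilHecke in
theorem proposition2p1 {ι V V' : Type*} [Finite ι] [AddCommGroup V] [Module ℚ V]
    [AddCommGroup V'] [Module ℚ V'] (P : RootPairing ι ℚ V V') [P.IsRootSystem]
    [P.IsCrystallographic] [P.IsReduced] (b : P.Base) (θ : ι) (hθ : IsHighestRoot b θ) :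
    (∃ φ : NilHecke b θ →ₐ[ℚ] BafS P,
      φ (NilHecke.τ b θ none) = BafS.mk P (P.reflectionPerm θ θ, -1) ∧
      (∀ i : b.support, φ (NilHecke.τ b θ (some i)) = BafS.mk P ((i : ι), 0)) ∧
      ∀ f : SymmetricAlgebra ℚ V, φ (NilHecke.ofSym b θ f) = BafS.ofSym P f) ∧
    (∀ i : AffineNode b, Baf.mk P (nodePair b θ i) * Baf.mk P (nodePair b θ i) = 0) ∧
    ∀ i j : AffineNode b, i ≠ j → coxeterOrder b θ i j ≠ 0 →
      altProd (Baf.mk P (nodePair b θ i)) (Baf.mk P (nodePair b θ j)) (coxeterOrder b θ i j) =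
        altProd (Baf.mk P (nodePair b θ j)) (Baf.mk P (nodePair b θ i))
          (coxeterOrder b θ i j) := by
  refine ⟨?_, fun i => Baf_mk_mul_self _, altProd_Baf_mk_nodePair_eq hθ⟩
  let u₀ : NilCoxeter b θ →ₐ[ℚ] Baf P :=
    RingQuot.liftAlgHom ℚ ⟨FreeAlgebra.lift ℚ fun i => Baf.mk P (nodePair b θ i), by
      intro x y hxy
      cases hxy with
      | sq i => simp [Baf_mk_mul_self]
      | braid i j hij hm =>
        simpa only [altProd, map_mul, map_pow, FreeAlgebra.lift_ι_apply] using
          altProd_Baf_mk_nodePair_eq hθ i j hij hm⟩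
  have hu₀ : ∀ i, u₀ (NilCoxeter.τ b θ i) = Baf.mk P (nodePair b θ i) := fun i =>
    (RingQuot.liftAlgHom_mkAlgHom_apply ℚ _ _ _).trans (FreeAlgebra.lift_ι_apply _ _)
  let u : NilCoxeter b θ →ₐ[ℚ] BafS P := (CrossedProduct.inl _ _ _).comp u₀
  have hu : ∀ i, u (NilCoxeter.τ b θ i) = BafS.mk P (nodePair b θ i) := fun i =>
    congrArg (CrossedProduct.inl (Baf.mk P) (fun a : ι × ℤ => symReflection P a.1)
      fun a => dividedDifference P a.1) (hu₀ i)
  refine ⟨CrossedProduct.lift _ _ _ u (BafS.ofSym P) fun i f => ?_, ?_, fun i => ?_, fun f => ?_⟩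
  -- The cross relation of [α, k] depends only on α, so the one for τ_i is the one for the pair of
  -- the node i.
  · rw [hu, ← nodePair_fst]
    exact CrossedProduct.inl_mul_inr _ _ _ (nodePair b θ i) f
  · exact (CrossedProduct.lift_inl _ _ _ _ _ _ _).trans (hu none)
  · exact (CrossedProduct.lift_inl _ _ _ _ _ _ _).trans (hu (some i))
  · exact CrossedProduct.lift_inr _ _ _ _ _ _ f
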